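/- **Setting.** Let $\Phi$ be the standard normal distribution function and $\Phi^{-1}$ its inverse on $(0,1)$. Let $\alpha\in(0,1)$, $\xi\in\mathbb R$, $\sigma>0$, and let $\rho_1,\rho_2$ satisfy $\rho_1^2\le\rho_2<1$. For $n\in\mathbb N=\{1,2,\dots\}$ let $\Sigma^{[n,1]}_{\rho_2}$ be the $n\times n$ matrix with diagonal entries $1$ and off-diagonal entries $\rho_2$, let $J_{n\times n}$ be the $n\times n$ matrix of ones, $\mathbf 1_n$ the vector of ones, and $$\Sigma^{[n,1]}_{\rho_1,\rho_2}=\begin{pmatrix}1&\rho_1\mathbf 1_n^{\mathrm T}\\ \rho_1\mathbf 1_n&\Sigma^{[n,1]}_{\rho_2}\end{pmatrix}$$ (a positive definite correlation matrix). Let $c_{(n)}$ be the density of the $(n+1)$-dimensional Gaussian copula with correlation matrix $R=\Sigma^{[n,1]}_{\rho_1,\rho_2}$, that is, $c_{(n)}(u)=(\det R)^{-1/2}\exp\!\big(-\tfrac12\zeta^{\mathrm T}(R^{-1}-I)\zeta\big)$ with $\zeta=(\Phi^{-1}(u_0),\dots,\Phi^{-1}(u_n))$ for $u\in(0,1)^{n+1}$.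 Let $F$ be a distribution function of a law on $\mathbb N_0$, let $G$ be the distribution function of $\mathrm N(\xi,\sigma^2)$, and put $$F_\alpha(n)=(1-\alpha)F(n-1)+\alpha F(n),\qquad \lceil u\rceil_{\alpha,F}=\sum_{k\in\mathbb N_0}F_\alpha(k)\,\mathbf 1_{(F(k-1),F(k)]}(u),$$ $$\mathfrak C_{(n)}(u,v)=\int_{[0,u]\times[0,v]}c_{(n)}\big(\lceil s\rceil_{\alpha,F},t\big)\,\mathrm d(s,t)\qquad(u\in[0,1],\ v\in[0,1]^n).$$ Let $(N,Y_1,\dots,Y_N)$ follow the transformed copula-based collective risk model with these data: $N\sim F$, and for every $n\in\mathbb N$ with $\mathbb P(N=n)>0$ the conditional distribution function of $(Y_1,\dots,Y_n)$ given $N=n$ is $$W^*_{(n)}(y)=\frac{\mathfrak C_{(n)}\big(F(n),G(y_1),\dots,G(y_n)\big)-\mathfrak C_{(n)}\big(F(n-1),G(y_1),\dots,G(y_n)\big)}{\mathbb P(N=n)}.$$ **(i)** Let $n\in\mathbb N$ with $\mathbb P(N=n)>0$ and put $q_n=\Phi^{-1}(F_\alpha(n))$. Then $$(Y_1,\dots,Y_n)\,|\,N=n\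 \sim\ \mathrm{MVN}\Big((\xi+\sigma\rho_1 q_n)\mathbf 1_n,\ \sigma^2\big(\Sigma^{[n,1]}_{\rho_2}-\rho_1^2J_{n\times n}\big)\Big).$$ Moreover, if $(Z_0,\dots,Z_n)$ is multivariate normal with mean $(0,\xi,\dots,\xi)^{\mathrm T}$ and covariance matrix $D\,\Sigma^{[n,1]}_{\rho_1,\rho_2}\,D$, where $D=\mathrm{diag}(1,\sigma,\dots,\sigma)$, then $(Z_1,\dots,Z_n)$ has a regular conditional distribution given $Z_0=z$ which is weakly continuous in $z\in\mathbb R$, and for any such version the conditional distribution of $(Z_1,\dots,Z_n)$ given $Z_0=q_n$ equals the conditional distribution of $(Y_1,\dots,Y_n)$ given $N=n$, hence equals the multivariate normal law above. **(ii)** Assume in addition $\rho_2=\rho_1^2$. Let $(X,Y'_1,\dots,Y'_X)$ follow the normal two-part collective risk model with the same frequency distribution: $X\sim F$, and for every $n\in\mathbb N$ with $\mathbb P(X=n)>0$, conditionally on $X=n$, the severities $Y'_1,\dots,Y'_n$ are independent with law $\mathrm N(\mu_n,\sigma_0^2)$, where $$\mu_n=\xi+\sigma\rho_1\Phi^{-1}(F_\alpha(n)),\qquad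 \sigma_0^2=\sigma^2(1-\rho_1^2).$$ Then the random vectors $(N,Y_1,\dots,Y_N)$ and $(X,Y'_1,\dots,Y'_X)$ of random length have the same distribution on $\bigsqcup_{n\ge0}\{n\}\times\mathbb R^n$. -/

import Mathlib

open MeasureTheory ProbabilityTheory Set
open scoped ENNReal NNReal Matrix

noncomputable section

namespace CRM

/-! ### The normal distribution function and its inverse -/

/-- The standard normal distribution function. -/
def Phi (x : ℝ) : ℝ := cdf (gaussianReal 0 1) x

/-- The standard normal quantile function (the pseudo-inverse of `Phi`); on `(0,1)` it is the
inverse function of `Phi`. -/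
def invPhi (p : ℝ) : ℝ := sInf {x : ℝ | p ≤ Phi x}

/-- The distribution function of the normal distribution with mean `ξ` and variance `σ ^ 2`. -/
def normalCDF (ξ σ : ℝ) (x : ℝ) : ℝ := cdf (gaussianReal ξ (σ ^ 2).toNNReal) x

lemma Phi_eq (x : ℝ) : Phi x = (gaussianReal 0 1).real (Iic x) := cdf_eq_real _ x

lemma strictMono_Phi : StrictMono Phi := by
  intro x y hxy
  rw [Phi_eq, Phi_eq]
  have h : Iic y = Iic x ∪ Ioc x y := (Iic_union_Ioc_eq_Iic hxy.le).symm
  rw [h, measureReal_union (by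
    rw [Set.disjoint_left]; intro z hz hz'; exact absurd hz'.1 (not_lt.mpr hz)) measurableSet_Ioc]
  have hpos : 0 < (gaussianReal 0 1).real (Ioc x y) := by
    rw [measureReal_def, ENNReal.toReal_pos_iff]
    refine ⟨?_, measure_lt_top _ _⟩
    rw [pos_iff_ne_zero]
    intro h0
    have := gaussianReal_absolutelyContinuous' 0 (v := 1) one_ne_zero h0
    rw [Real.volume_Ioc, ENNReal.ofReal_eq_zero] at this
    linarith
  linarith

lemma continuous_Phi : Continuous Phi := by
  have hna : NullSingletonClass (gaussianReal 0 1) :=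
    nullSingletonClass_gaussianReal one_ne_zero
  rw [continuous_iff_continuousAt]
  intro x
  have h := (cdf (gaussianReal 0 1)).mono.continuousAt_iff_leftLim_eq_rightLim (x := x)
  refine h.2 ?_
  rw [StieltjesFunction.rightLim_eq]
  have h1 : (cdf (gaussianReal 0 1)).measure {x} = 0 := by
    rw [measure_cdf]; exact measure_singleton x
  rw [StieltjesFunction.measure_singleton, ENNReal.ofReal_eq_zero] at h1
  have h2 := (cdf (gaussianReal 0 1)).mono.leftLim_le (le_refl x)
  linarith

lemma Phi_mem (x : ℝ) : Phi x ∈ Ioo (0 : ℝ) 1 := by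
  constructor
  · have h1 : Phi (x - 1) < Phi x := strictMono_Phi (by linarith)
    have h2 : 0 ≤ Phi (x - 1) := cdf_nonneg _ _
    linarith
  · have h1 : Phi x < Phi (x + 1) := strictMono_Phi (by linarith)
    have h2 : Phi (x + 1) ≤ 1 := cdf_le_one _ _
    linarith

lemma invPhi_Phi (x : ℝ) : invPhi (Phi x) = x := by
  have : {y : ℝ | Phi x ≤ Phi y} = Ici x := by
    ext y; exact strictMono_Phi.le_iff_le
  rw [invPhi, this, csInf_Ici]

lemma exists_Phi_eq {p : ℝ} (hp : p ∈ Ioo (0 : ℝ) 1) : ∃ x, Phi x = p := by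
  have hbot := tendsto_cdf_atBot (gaussianReal 0 1)
  have htop := tendsto_cdf_atTop (gaussianReal 0 1)
  obtain ⟨a, ha⟩ := (hbot.eventually (gt_mem_nhds hp.1)).exists
  obtain ⟨b, hb⟩ := (htop.eventually (lt_mem_nhds hp.2)).exists
  exact mem_range_of_exists_le_of_exists_ge continuous_Phi ⟨a, ha.le⟩ ⟨b, hb.le⟩

lemma invPhi_of_le {p : ℝ} (hp : p ≤ 0) : invPhi p = 0 := by
  have : {y : ℝ | p ≤ Phi y} = univ := by
    ext y; simpa using hp.trans (Phi_mem y).1.le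
  rw [invPhi, this, Real.sInf_univ]

lemma invPhi_of_ge {p : ℝ} (hp : 1 ≤ p) : invPhi p = 0 := by
  have : {y : ℝ | p ≤ Phi y} = ∅ := by
    ext y; simpa using (Phi_mem y).2.trans_le hp
  rw [invPhi, this, Real.sInf_empty]

lemma measurable_invPhi : Measurable invPhi := by
  have hemb : MeasurableEmbedding Phi :=
    continuous_Phi.measurableEmbedding strictMono_Phi.injective
  intro s hs
  have : invPhi ⁻¹' s = Phi '' s ∪ ((Ioo (0 : ℝ) 1)ᶜ ∩ {_x | (0 : ℝ) ∈ s}) := by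
    ext p
    by_cases hp : p ∈ Ioo (0 : ℝ) 1
    · obtain ⟨x, rfl⟩ := exists_Phi_eq hp
      simp [invPhi_Phi, strictMono_Phi.injective.eq_iff, hp.1, hp.2]
    · have h0 : invPhi p = 0 := by
        rcases le_or_gt p 0 with h | h
        · exact invPhi_of_le h
        · exact invPhi_of_ge (not_lt.mp fun h' => hp ⟨h, h'⟩)
      have h1 : p ∉ Phi '' s := by
        rintro ⟨x, -, rfl⟩; exact hp (Phi_mem x)
      simp only [mem_preimage, h0, mem_union, h1, false_or, mem_inter_iff, mem_compl_iff, hp,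
        not_false_eq_true, true_and, mem_ofPred_eq]
  rw [this]
  exact (hemb.measurableSet_image.2 hs).union (measurableSet_Ioo.compl.inter (MeasurableSet.const _))

/-- Probability integral transform. -/
lemma map_Phi : (gaussianReal 0 1).map Phi = (volume : Measure ℝ).restrict (Icc 0 1) := by
  have : IsProbabilityMeasure ((gaussianReal 0 1).map Phi) :=
    Measure.isProbabilityMeasure_map continuous_Phi.measurable.aemeasurable
  refine Measure.ext_of_Iic _ _ fun u => ?_
  rw [Measure.map_apply continuous_Phi.measurable measurableSet_Iic,
    Measure.restrict_apply measurableSet_Iic]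
  rcases le_or_gt u 0 with h | h
  · have h1 : Phi ⁻¹' Iic u = ∅ := by
      ext x; simpa using h.trans_lt (Phi_mem x).1
    have h2 : (Iic u ∩ Icc (0 : ℝ) 1) ⊆ {0} := by
      rintro x ⟨hx, hx', -⟩; exact le_antisymm (le_trans hx h) hx'
    rw [h1, measure_empty]
    exact (measure_mono_null h2 (by simp)).symm
  · rcases le_or_gt 1 u with h' | h'
    · have h1 : Phi ⁻¹' Iic u = univ := by
        ext x; simpa using (Phi_mem x).2.le.trans h'
      have h2 : (Iic u ∩ Icc (0 : ℝ) 1) = Icc 0 1 :=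
        inter_eq_right.2 fun x hx => hx.2.trans h'
      rw [h1, h2, measure_univ]; simp
    · obtain ⟨x, rfl⟩ := exists_Phi_eq ⟨h, h'⟩
      have h1 : Phi ⁻¹' Iic (Phi x) = Iic x := by
        ext y; exact strictMono_Phi.le_iff_le
      have h2 : (Iic (Phi x) ∩ Icc (0 : ℝ) 1) = Icc 0 (Phi x) := by
        ext y; simp only [mem_inter_iff, mem_Iic, mem_Icc]
        constructor
        · rintro ⟨a, b, c⟩; exact ⟨b, a⟩
        · rintro ⟨a, b⟩; exact ⟨b, a, b.trans h'.le⟩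
      rw [h1, h2, Real.volume_Icc, sub_zero]
      exact (ofReal_cdf _ _).symm

/-! ### Absolutely continuous copulas and the Gaussian copula -/

/-- An absolutely continuous `d`-dimensional copula, given by a (version of its) density on the
unit cube: a nonnegative function for which every margin is uniform on `[0,1]`. -/
structure AbsContCopula (d : ℕ) where
  density : (Fin d → ℝ) → ℝ
  measurable_density : Measurable density
  density_nonneg : ∀ t, 0 ≤ density t
  uniform_margin : ∀ (i : Fin d), ∀ u ∈ Icc (0 : ℝ) 1,
    ∫⁻ t in {t | t ∈ Icc (0 : Fin d → ℝ) 1 ∧ t i ≤ u}, ENNReal.ofReal (density t)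
      = ENNReal.ofReal u

/-- The copula itself: the distribution function of its density. -/
def AbsContCopula.toFun {d : ℕ} (C : AbsContCopula d) (u : Fin d → ℝ) : ℝ :=
  ∫ t in Icc 0 u, C.density t

/-- The density of the Gaussian copula with correlation matrix `R`:
`c(u; R) = (det R)^{-1/2} exp(-ζᵀ (R⁻¹ - I) ζ / 2)` with `ζ = (Φ⁻¹(u_0), Φ⁻¹(u_1), …)`. -/
def gaussianCopulaDensity {d : ℕ} (R : Matrix (Fin d) (Fin d) ℝ) (u : Fin d → ℝ) : ℝ :=
  (Real.sqrt R.det)⁻¹ *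
    Real.exp (-((fun i => invPhi (u i)) ⬝ᵥ ((R⁻¹ - 1) *ᵥ (fun i => invPhi (u i)))) / 2)

lemma measurable_gaussianCopulaDensity {d : ℕ} (R : Matrix (Fin d) (Fin d) ℝ) :
    Measurable (gaussianCopulaDensity R) := by
  have h (i : Fin d) : Measurable fun u : Fin d → ℝ => invPhi (u i) :=
    measurable_invPhi.comp (measurable_pi_apply i)
  unfold gaussianCopulaDensity dotProduct Matrix.mulVec dotProduct
  fun_prop

lemma gaussianCopulaDensity_nonneg {d : ℕ} (R : Matrix (Fin d) (Fin d) ℝ) (u : Fin d → ℝ) :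
    0 ≤ gaussianCopulaDensity R u := by
  unfold gaussianCopulaDensity; positivity

lemma pi_gaussian_eq (d : ℕ) :
    Measure.pi (fun _ : Fin d => gaussianReal 0 1) =
      (volume : Measure (Fin d → ℝ)).withDensity
        (fun x => ENNReal.ofReal (∏ i, gaussianPDFReal 0 1 (x i))) := by
  refine Measure.pi_eq fun s hs => ?_
  rw [withDensity_apply _ (MeasurableSet.univ_pi hs), volume_pi, Measure.restrict_pi_pi,
    ← ofReal_integral_eq_lintegral_ofReal]
  · rw [integral_fintype_prod_eq_prod (fun _ => gaussianPDFReal 0 1), ENNReal.ofReal_prod_of_nonneg]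
    · refine Finset.prod_congr rfl fun i _ => ?_
      rw [gaussianReal_apply_eq_integral _ one_ne_zero]
    · intro i _
      exact integral_nonneg fun x => gaussianPDFReal_nonneg _ _ _
  · exact Integrable.fintype_prod (f := fun _ => gaussianPDFReal 0 1)
      fun i => (integrable_gaussianPDFReal 0 1).restrict
  · exact ae_of_all _ fun x => Finset.prod_nonneg fun i _ => gaussianPDFReal_nonneg _ _ _

lemma prod_gaussianPDFReal {d : ℕ} (x : Fin d → ℝ) :
    ∏ i, gaussianPDFReal 0 1 (x i) =
      ((Real.sqrt (2 * Real.pi))⁻¹) ^ d * Real.exp (-(x ⬝ᵥ x) / 2) := by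
  simp only [gaussianPDFReal_def, Finset.prod_mul_distrib, Finset.prod_const, Finset.card_univ,
    Fintype.card_fin, ← Real.exp_sum]
  simp [dotProduct, Finset.sum_neg_distrib, Finset.sum_div, neg_div, pow_two]

open scoped MatrixOrder in
lemma multivariateGaussian_map_ofLp {d : ℕ} {R : Matrix (Fin d) (Fin d) ℝ} (hR : R.PosDef) :
    (multivariateGaussian 0 R).map (fun z : EuclideanSpace ℝ (Fin d) => (fun i => z i)) =
      (Measure.pi (fun _ : Fin d => gaussianReal 0 1)).withDensity
        (fun z => ENNReal.ofReal (gaussianCopulaDensity R (fun i => Phi (z i)))) := by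
  set A : Matrix (Fin d) (Fin d) ℝ := CFC.sqrt R with hA
  have hAA : A * A = R := by
    exact CFC.sqrt_mul_sqrt_self _ hR.posSemidef.nonneg
  have hAsymm : Aᵀ = A := by
    have := (Matrix.nonneg_iff_posSemidef.1 (CFC.sqrt_nonneg R)).isHermitian
    rwa [Matrix.IsHermitian, Matrix.conjTranspose_eq_transpose_of_trivial] at this
  have hdetR : 0 < R.det := hR.det_pos
  have hdetAA : A.det * A.det = R.det := by rw [← Matrix.det_mul, hAA]
  have hdetA : A.det ≠ 0 := by
    intro h; rw [h] at hdetAA; simp at hdetAA; linarith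
  have habs : |A.det| = Real.sqrt R.det := by
    rw [← hdetAA, Real.sqrt_mul_self_eq_abs]
  have hmul : (fun x : Fin d → ℝ => A *ᵥ x) = Matrix.toLin' A := by ext; simp
  have hmeasA : Measurable (fun x : Fin d → ℝ => A *ᵥ x) := by
    rw [hmul]; exact (LinearMap.continuous_of_finiteDimensional _).measurable
  have hmeasA' : Measurable (fun x : Fin d → ℝ => A⁻¹ *ᵥ x) := by
    have : (fun x : Fin d → ℝ => A⁻¹ *ᵥ x) = Matrix.toLin' A⁻¹ := by ext; simp
    rw [this]; exact (LinearMap.continuous_of_finiteDimensional _).measurable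
  have h1 : (multivariateGaussian 0 R).map (fun z : EuclideanSpace ℝ (Fin d) => (fun i => z i)) =
      (Measure.pi (fun _ : Fin d => gaussianReal 0 1)).map (fun x => A *ᵥ x) := by
    rw [multivariateGaussian, ← map_pi_eq_stdGaussian, Measure.map_map (by fun_prop) (by fun_prop),
      Measure.map_map (by fun_prop) (by fun_prop)]
    congr 1
    ext x i
    simp [Matrix.toEuclideanCLM_toLp, hA]
  have hP : Measurable fun x : Fin d → ℝ => ENNReal.ofReal (∏ i, gaussianPDFReal 0 1 (x i)) := by
    have h (i : Fin d) : Measurable fun u : Fin d → ℝ => gaussianPDFReal 0 1 (u i) :=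
      (measurable_gaussianPDFReal 0 1).comp (measurable_pi_apply i)
    fun_prop
  have hP' : Measurable fun z : Fin d → ℝ =>
      ENNReal.ofReal (∏ i, gaussianPDFReal 0 1 ((A⁻¹ *ᵥ z) i)) := hP.comp hmeasA'
  have hc : Measurable fun z : Fin d → ℝ =>
      ENNReal.ofReal (gaussianCopulaDensity R (fun i => Phi (z i))) := by
    refine ENNReal.measurable_ofReal.comp ((measurable_gaussianCopulaDensity R).comp ?_)
    exact measurable_pi_lambda _ fun i => continuous_Phi.measurable.comp (measurable_pi_apply i)
  rw [h1]
  ext s hs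
  rw [Measure.map_apply hmeasA hs, withDensity_apply _ hs, pi_gaussian_eq,
    withDensity_apply _ (hmeasA hs), setLIntegral_withDensity_eq_setLIntegral_mul _ hP hc hs]
  have h2 : ∫⁻ x in (fun x : Fin d → ℝ => A *ᵥ x) ⁻¹' s,
        ENNReal.ofReal (∏ i, gaussianPDFReal 0 1 (x i)) =
      ∫⁻ z in s, ENNReal.ofReal (∏ i, gaussianPDFReal 0 1 ((A⁻¹ *ᵥ z) i))
        ∂(Measure.map (Matrix.toLin' A) volume) := by
    rw [← hmul, setLIntegral_map hs hP' hmeasA]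
    refine lintegral_congr fun x => ?_
    rw [Matrix.mulVec_mulVec, Matrix.nonsing_inv_mul _ (Ne.isUnit hdetA), Matrix.one_mulVec]
  rw [h2, Real.map_matrix_volume_pi_eq_smul_volume_pi hdetA, Measure.restrict_smul,
    lintegral_smul_measure, smul_eq_mul, ← lintegral_const_mul _ hP']
  refine lintegral_congr fun z => ?_
  simp only [Pi.mul_apply]
  rw [← ENNReal.ofReal_mul (abs_nonneg _), ← ENNReal.ofReal_mul (Finset.prod_nonneg fun i _ =>
    gaussianPDFReal_nonneg _ _ _)]
  congr 1
  rw [prod_gaussianPDFReal, prod_gaussianPDFReal, abs_inv, habs]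
  unfold gaussianCopulaDensity
  simp only [invPhi_Phi]
  have h3 : (A⁻¹ *ᵥ z) ⬝ᵥ (A⁻¹ *ᵥ z) = z ⬝ᵥ (R⁻¹ *ᵥ z) := by
    have hsymm : (A⁻¹)ᵀ = A⁻¹ := by rw [Matrix.transpose_nonsing_inv, hAsymm]
    rw [← hAA, Matrix.mul_inv_rev, ← Matrix.mulVec_mulVec, Matrix.dotProduct_mulVec z,
      ← Matrix.mulVec_transpose, hsymm]
  have h4 : Real.exp (-((A⁻¹ *ᵥ z) ⬝ᵥ (A⁻¹ *ᵥ z)) / 2) =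
      Real.exp (-(z ⬝ᵥ z) / 2) * Real.exp (-(z ⬝ᵥ ((R⁻¹ - 1) *ᵥ z)) / 2) := by
    rw [h3, ← Real.exp_add, Matrix.sub_mulVec, Matrix.one_mulVec, dotProduct_sub]
    congr 1; ring
  have h5 : (fun i => z i) = z := rfl
  rw [h4]
  ring

lemma multivariateGaussian_map_Phi {d : ℕ} {R : Matrix (Fin d) (Fin d) ℝ} (hR : R.PosDef) :
    (multivariateGaussian 0 R).map (fun z : EuclideanSpace ℝ (Fin d) => (fun i => Phi (z i))) =
      ((volume : Measure (Fin d → ℝ)).restrict (Icc 0 1)).withDensity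
        (fun u => ENNReal.ofReal (gaussianCopulaDensity R u)) := by
  have hPhi : Measurable fun (z : Fin d → ℝ) (i : Fin d) => Phi (z i) :=
    measurable_pi_lambda _ fun i => continuous_Phi.measurable.comp (measurable_pi_apply i)
  have hc : Measurable fun u : Fin d → ℝ => ENNReal.ofReal (gaussianCopulaDensity R u) :=
    ENNReal.measurable_ofReal.comp (measurable_gaussianCopulaDensity R)
  have hcube : (Measure.pi (fun _ : Fin d => gaussianReal 0 1)).map
      (fun (z : Fin d → ℝ) (i : Fin d) => Phi (z i)) =
      (volume : Measure (Fin d → ℝ)).restrict (Icc 0 1) := by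
    have : ∀ i : Fin d, SigmaFinite ((gaussianReal 0 1).map Phi) := by
      intro i; rw [map_Phi]; infer_instance
    rw [Measure.pi_map_pi (fun _ => continuous_Phi.measurable.aemeasurable)]
    simp only [map_Phi]
    rw [← Measure.restrict_pi_pi, ← volume_pi, Set.pi_univ_Icc]
    rfl
  have h1 : (fun z : EuclideanSpace ℝ (Fin d) => (fun i => Phi (z i))) =
      (fun (z : Fin d → ℝ) (i : Fin d) => Phi (z i)) ∘
        (fun z : EuclideanSpace ℝ (Fin d) => (fun i => z i)) := rfl
  rw [h1, ← Measure.map_map hPhi (by fun_prop), multivariateGaussian_map_ofLp hR, ← hcube]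
  ext s hs
  rw [Measure.map_apply hPhi hs, withDensity_apply _ (hPhi hs), withDensity_apply _ hs,
    setLIntegral_map hs hc hPhi]

/-- The `d`-dimensional Gaussian copula with positive definite correlation matrix `R`. -/
def gaussianCopula {d : ℕ} (R : Matrix (Fin d) (Fin d) ℝ) (hR : R.PosDef)
    (hdiag : ∀ i, R i i = 1) : AbsContCopula d where
  density := gaussianCopulaDensity R
  measurable_density := measurable_gaussianCopulaDensity R
  density_nonneg := gaussianCopulaDensity_nonneg R
  uniform_margin := by
    intro i u hu
    have hs : MeasurableSet {t : Fin d → ℝ | t i ≤ u} :=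
      measurableSet_le (measurable_pi_apply i) measurable_const
    have h1 : {t : Fin d → ℝ | t ∈ Icc (0 : Fin d → ℝ) 1 ∧ t i ≤ u} =
        {t | t i ≤ u} ∩ Icc 0 1 := by
      ext t; exact and_comm
    have hPhi : Measurable fun z : EuclideanSpace ℝ (Fin d) => (fun i => Phi (z i)) :=
      measurable_pi_lambda _ fun i => continuous_Phi.measurable.comp (by fun_prop)
    rw [h1, ← Measure.restrict_restrict hs, ← withDensity_apply _ hs,
      ← multivariateGaussian_map_Phi hR, Measure.map_apply hPhi hs]
    have h2 := (measurePreserving_eval_multivariateGaussian (μ := 0) hR.posSemidef (i := i))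
    rw [hdiag i] at h2
    have h3 : (fun z : EuclideanSpace ℝ (Fin d) => (fun i => Phi (z i))) ⁻¹' {t | t i ≤ u} =
        (fun z : EuclideanSpace ℝ (Fin d) => z i) ⁻¹' (Phi ⁻¹' Iic u) := rfl
    rw [h3, h2.measure_preimage (continuous_Phi.measurable measurableSet_Iic).nullMeasurableSet]
    have h4 : gaussianReal ((0 : EuclideanSpace ℝ (Fin d)) i) (1 : ℝ).toNNReal =
        gaussianReal 0 1 := by simp
    rw [h4, ← Measure.map_apply continuous_Phi.measurable measurableSet_Iic, map_Phi,
      Measure.restrict_apply measurableSet_Iic]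
    have h5 : Iic u ∩ Icc (0 : ℝ) 1 = Icc 0 u := by
      ext y; simp only [mem_inter_iff, mem_Iic, mem_Icc]
      constructor
      · rintro ⟨a, b, c⟩; exact ⟨b, a⟩
      · rintro ⟨a, b⟩; exact ⟨b, a, b.trans hu.2⟩
    rw [h5, Real.volume_Icc, sub_zero]

/-- The Gaussian copula is the distribution function of `(Φ(Z_0), Φ(Z_1), …)` for a centred normal
vector `Z` with covariance matrix `R`. -/
lemma gaussianCopula_toFun {d : ℕ} (R : Matrix (Fin d) (Fin d) ℝ) (hR : R.PosDef)
    (hdiag : ∀ i, R i i = 1) {u : Fin d → ℝ} (hu : u ∈ Icc (0 : Fin d → ℝ) 1) :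
    (gaussianCopula R hR hdiag).toFun u =
      (multivariateGaussian 0 R).real {z | ∀ i, Phi (z i) ≤ u i} := by
  have hPhi : Measurable fun z : EuclideanSpace ℝ (Fin d) => (fun i => Phi (z i)) :=
    measurable_pi_lambda _ fun i => continuous_Phi.measurable.comp (by fun_prop)
  have h1 : {z : EuclideanSpace ℝ (Fin d) | ∀ i, Phi (z i) ≤ u i} =
      (fun z : EuclideanSpace ℝ (Fin d) => (fun i => Phi (z i))) ⁻¹' Icc 0 u := by
    ext z
    exact ⟨fun h => ⟨fun i => (Phi_mem _).1.le, h⟩, fun h => h.2⟩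
  have h2 : Icc (0 : Fin d → ℝ) u ∩ Icc 0 1 = Icc 0 u :=
    inter_eq_left.2 fun t ht => ⟨ht.1, ht.2.trans hu.2⟩
  rw [h1, measureReal_def, ← Measure.map_apply hPhi measurableSet_Icc,
    multivariateGaussian_map_Phi hR, withDensity_apply _ measurableSet_Icc,
    Measure.restrict_restrict measurableSet_Icc, h2, AbsContCopula.toFun,
    integral_eq_lintegral_of_nonneg_ae
      (ae_of_all _ (gaussianCopula R hR hdiag).density_nonneg)
      (gaussianCopula R hR hdiag).measurable_density.aestronglyMeasurable]
  rfl

/-! ### The exchangeable correlation matrices -/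

/-- The exchangeable `k × k` matrix `Σ_ρ^{[k,1]}`: ones on the diagonal, `ρ` elsewhere. -/
def exchMatrix (k : ℕ) (ρ : ℝ) : Matrix (Fin k) (Fin k) ℝ :=
  Matrix.of fun i j => if i = j then 1 else ρ

/-- The `k × k` matrix with all entries `1`. -/
def onesMatrix (k : ℕ) : Matrix (Fin k) (Fin k) ℝ := Matrix.of fun _ _ => 1

/-- The `(k+1) × (k+1)` block matrix `Σ_{ρ₁,ρ₂}^{[k,1]}` with first row `(1, ρ₁, …, ρ₁)`, first
column `(1, ρ₁, …, ρ₁)ᵀ` and lower right block `Σ_{ρ₂}^{[k,1]}`. -/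
def corrMatrix (k : ℕ) (ρ₁ ρ₂ : ℝ) : Matrix (Fin (k + 1)) (Fin (k + 1)) ℝ :=
  Matrix.of (Fin.cons (Fin.cons 1 fun _ => ρ₁) fun i => Fin.cons ρ₁ fun j => exchMatrix k ρ₂ i j)

lemma corrMatrix_diag (k : ℕ) (ρ₁ ρ₂ : ℝ) (i : Fin (k + 1)) : corrMatrix k ρ₁ ρ₂ i i = 1 := by
  refine Fin.cases ?_ (fun i => ?_) i <;> simp [corrMatrix, exchMatrix]

lemma corrMatrix_posDef (k : ℕ) {ρ₁ ρ₂ : ℝ} (h₁ : ρ₁ ^ 2 ≤ ρ₂) (h₂ : ρ₂ < 1) :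
    (corrMatrix k ρ₁ ρ₂).PosDef := by
  refine Matrix.PosDef.of_dotProduct_mulVec_pos ?_ fun x hx => ?_
  · ext i j
    refine Fin.cases ?_ (fun i => ?_) i <;> refine Fin.cases ?_ (fun j => ?_) j <;>
      simp [corrMatrix, exchMatrix, Matrix.conjTranspose_apply, eq_comm]
  · have hrow (i : Fin k) : ∑ j, exchMatrix k ρ₂ i j * x j.succ =
        (1 - ρ₂) * x i.succ + ρ₂ * ∑ j : Fin k, x j.succ := by
      have : ∀ j, exchMatrix k ρ₂ i j * x j.succ =
          (if i = j then (1 - ρ₂) * x j.succ else 0) + ρ₂ * x j.succ := by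
        intro j; by_cases h : i = j <;> (simp [exchMatrix, h]; try ring)
      simp only [this, Finset.sum_add_distrib, Finset.mul_sum]
      simp
    have hq : star x ⬝ᵥ (corrMatrix k ρ₁ ρ₂ *ᵥ x) =
        (x 0 + ρ₁ * ∑ j : Fin k, x j.succ) ^ 2 + (1 - ρ₂) * ∑ j : Fin k, x j.succ ^ 2 +
          (ρ₂ - ρ₁ ^ 2) * (∑ j : Fin k, x j.succ) ^ 2 := by
      have h0 : (corrMatrix k ρ₁ ρ₂ *ᵥ x) 0 = x 0 + ρ₁ * ∑ j : Fin k, x j.succ := by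
        simp [Matrix.mulVec, dotProduct, Fin.sum_univ_succ, corrMatrix, Finset.mul_sum]
      have hs (i : Fin k) : (corrMatrix k ρ₁ ρ₂ *ᵥ x) i.succ =
          ρ₁ * x 0 + ((1 - ρ₂) * x i.succ + ρ₂ * ∑ j : Fin k, x j.succ) := by
        rw [← hrow i]
        simp [Matrix.mulVec, dotProduct, Fin.sum_univ_succ, corrMatrix]
      rw [dotProduct, Fin.sum_univ_succ, h0]
      simp only [hs, star_trivial]
      have h3 : ∑ i : Fin k, x i.succ * (ρ₁ * x 0 + ((1 - ρ₂) * x i.succ +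
          ρ₂ * ∑ j : Fin k, x j.succ)) =
          (ρ₁ * x 0 + ρ₂ * ∑ j : Fin k, x j.succ) * (∑ j : Fin k, x j.succ) +
          (1 - ρ₂) * ∑ j : Fin k, x j.succ ^ 2 := by
        have hgen (S : ℝ) : ∑ i : Fin k, x i.succ * (ρ₁ * x 0 + ((1 - ρ₂) * x i.succ + ρ₂ * S)) =
            (ρ₁ * x 0 + ρ₂ * S) * (∑ j : Fin k, x j.succ) +
            (1 - ρ₂) * ∑ j : Fin k, x j.succ ^ 2 := by
          rw [Finset.mul_sum, Finset.mul_sum, ← Finset.sum_add_distrib]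
          exact Finset.sum_congr rfl fun i _ => by ring
        exact hgen _
      rw [h3]; ring
    rw [hq]
    have hB : 0 ≤ (ρ₂ - ρ₁ ^ 2) * (∑ j : Fin k, x j.succ) ^ 2 :=
      mul_nonneg (by linarith) (sq_nonneg _)
    have hA : 0 ≤ (x 0 + ρ₁ * ∑ j : Fin k, x j.succ) ^ 2 := sq_nonneg _
    by_cases hz : ∀ j : Fin k, x j.succ = 0
    · have hx0 : x 0 ≠ 0 := by
        intro h; apply hx; ext i; exact Fin.cases h hz i
      have : 0 < x 0 ^ 2 := by positivity
      simpa [hz] using this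
    · push Not at hz
      obtain ⟨j, hj⟩ := hz
      have : 0 < ∑ j : Fin k, x j.succ ^ 2 :=
        Finset.sum_pos' (fun i _ => sq_nonneg _) ⟨j, Finset.mem_univ _, by positivity⟩
      have := mul_pos (sub_pos.2 h₂) this
      linarith

/-- The `(n+1)`-dimensional Gaussian copula with correlation matrix `Σ_{ρ₁,ρ₂}^{[n,1]}`. -/
def exchGaussianCopula {ρ₁ ρ₂ : ℝ} (h₁ : ρ₁ ^ 2 ≤ ρ₂) (h₂ : ρ₂ < 1) (n : ℕ) :
    AbsContCopula (n + 1) :=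
  gaussianCopula (corrMatrix n ρ₁ ρ₂) (corrMatrix_posDef n h₁ h₂) (corrMatrix_diag n ρ₁ ρ₂)

/-! ### The copula transformation -/

/-- `F_α(n) = (1 - α) F(n-1) + α F(n)`. -/
def Falpha (α : ℝ) (F : ℝ → ℝ) (n : ℕ) : ℝ := (1 - α) * F ((n : ℝ) - 1) + α * F n

/-- `⌈u⌉_{α,F} = ∑_n F_α(n) 1_{(F(n-1), F(n)]}(u)`. -/
def ceilMap (α : ℝ) (F : ℝ → ℝ) (u : ℝ) : ℝ :=
  ∑' n : ℕ, (Ioc (F ((n : ℝ) - 1)) (F n)).indicator (fun _ => Falpha α F n) u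

/-- The transformed density `(u, v) ↦ c(⌈u⌉_{α,F}, v)`. -/
def transformedDensity (α : ℝ) (F : ℝ → ℝ) {d : ℕ} (C : AbsContCopula (d + 1))
    (t : Fin (d + 1) → ℝ) : ℝ :=
  C.density (Fin.cons (ceilMap α F (t 0)) (Fin.tail t))

/-- The transformed copula: `(u, v) ↦ ∫_{[0,u] × [0,v]} c(⌈s⌉_{α,F}, t) d(s, t)`. -/
def transformedCopula (α : ℝ) (F : ℝ → ℝ) {d : ℕ} (C : AbsContCopula (d + 1))
    (u : ℝ) (v : Fin d → ℝ) : ℝ :=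
  ∫ t in Icc (0 : Fin (d + 1) → ℝ) (Fin.cons u v), transformedDensity α F C t

/-! ### Collective risk models

The number of claims is `N : Ω → ℕ`; the individual severities are `Y 0, Y 1, …`, where `Y i` is
the severity of claim number `i + 1`. Only `Y 0, …, Y (N - 1)` enter the models. -/

variable {Ω : Type*} [MeasurableSpace Ω]

/-- The vector of the first `n` severities. -/
def severities (Y : ℕ → Ω → ℝ) (n : ℕ) (ω : Ω) : EuclideanSpace ℝ (Fin n) :=
  WithLp.toLp 2 fun i => Y i ω

/-- The random vector `(N, Y_1, …, Y_N)` of random length. -/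
def crmVector (N : Ω → ℕ) (Y : ℕ → Ω → ℝ) (ω : Ω) : Σ n : ℕ, (Fin n → ℝ) :=
  ⟨N ω, fun i => Y i ω⟩

/-- The transformed copula-based collective risk model: `N ∼ F`, and conditionally on `N = n ≥ 1`
(whenever this has positive probability) the vector `(Y_1, …, Y_n)` has distribution function
`W*_n(y) = (ℭ_n(F(n), G(y_1), …, G(y_n)) - ℭ_n(F(n-1), G(y_1), …, G(y_n))) / P(N = n)`, where `ℭ_n`
is the transform of the absolutely continuous `(n+1)`-dimensional copula `C n`. -/
structure TransformedCopulaCRM (P : Measure Ω) (α : ℝ) (F G : ℝ → ℝ)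
    (C : ∀ n : ℕ, AbsContCopula (n + 1)) (N : Ω → ℕ) (Y : ℕ → Ω → ℝ) : Prop where
  measurable_frequency : Measurable N
  measurable_severity : ∀ i, Measurable (Y i)
  frequency : ∀ x : ℝ, P.real {ω | (N ω : ℝ) ≤ x} = F x
  severity : ∀ n : ℕ, 1 ≤ n → P (N ⁻¹' {n}) ≠ 0 → ∀ y : Fin n → ℝ,
    (P[|N ⁻¹' {n}]).real {ω | ∀ i : Fin n, Y i ω ≤ y i} =
      (transformedCopula α F (C n) (F n) (fun i => G (y i)) -
        transformedCopula α F (C n) (F ((n : ℝ) - 1)) (fun i => G (y i))) / P.real (N ⁻¹' {n})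

/-- A reproductive exponential dispersion model: a family of laws `ED(μ, σ²)`, indexed by the mean
`μ = κ'(θ)` and the dispersion `σ² = 1/λ`, of the form
`exp(λ(θ y - κ(θ))) dν_λ(y)` with cumulant function `κ`. -/
structure ReproductiveED where
  /-- the canonical parameters `θ` -/
  canonical : Set ℝ
  isOpen_canonical : IsOpen canonical
  /-- the index parameters `λ > 0` -/
  index : Set ℝ
  index_pos : ∀ l ∈ index, 0 < l
  cumulant : ℝ → ℝ
  differentiable_cumulant : DifferentiableOn ℝ cumulant canonical
  base : ℝ → Measure ℝ
  /-- the law `ED(μ, σ²)` as a function of the mean and the dispersion -/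
  law : ℝ → ℝ → Measure ℝ
  isProbabilityMeasure_law : ∀ θ ∈ canonical, ∀ l ∈ index,
    IsProbabilityMeasure (law (deriv cumulant θ) l⁻¹)
  law_eq : ∀ θ ∈ canonical, ∀ l ∈ index, law (deriv cumulant θ) l⁻¹ =
    (base l).withDensity fun y => ENNReal.ofReal (Real.exp (l * (θ * y - cumulant θ)))

/-- The normal laws `N(μ, σ²)` as a reproductive exponential dispersion model, `κ(θ) = θ²/2`. -/
def normalED : ReproductiveED where
  canonical := univ
  isOpen_canonical := isOpen_univ
  index := Ioi 0
  index_pos := fun _ hl => hl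
  cumulant := fun θ => θ ^ 2 / 2
  differentiable_cumulant := by fun_prop
  base := fun l => gaussianReal 0 l⁻¹.toNNReal
  law := fun μ s => gaussianReal μ s.toNNReal
  isProbabilityMeasure_law := fun _ _ _ _ => inferInstance
  law_eq := by
    intro θ _ l hl
    have hl' : (0 : ℝ) < l := hl
    have hd : deriv (fun θ : ℝ => θ ^ 2 / 2) θ = θ := by simp
    have hv : l⁻¹.toNNReal ≠ 0 := by simpa using hl'
    have hc : ((l⁻¹.toNNReal : ℝ≥0) : ℝ) = l⁻¹ := Real.coe_toNNReal _ (inv_pos.2 hl').le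
    rw [hd, gaussianReal_of_var_ne_zero _ hv, gaussianReal_of_var_ne_zero _ hv,
      ← withDensity_mul _ (measurable_gaussianPDF _ _) (by fun_prop)]
    congr 1
    ext y
    rw [Pi.mul_apply, gaussianPDF, gaussianPDF,
      ← ENNReal.ofReal_mul (gaussianPDFReal_nonneg _ _ _)]
    congr 1
    rw [gaussianPDFReal, gaussianPDFReal, mul_assoc _ (Real.exp _), ← Real.exp_add, hc]
    congr 2
    field_simp
    ring

/-- The two part collective risk model for frequency and individual severities: `X ∼ F`, and
conditionally on `X = n ≥ 1` (whenever this has positive probability) the severities `Y_1, …, Y_n`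
are independent with common law `ED(μ n, σ₀²)`. -/
structure TwoPartCRM (P : Measure Ω) (F : ℝ → ℝ) (E : ReproductiveED) (μ : ℕ → ℝ) (σ₀sq : ℝ)
    (X : Ω → ℕ) (Y : ℕ → Ω → ℝ) : Prop where
  measurable_frequency : Measurable X
  measurable_severity : ∀ i, Measurable (Y i)
  frequency : ∀ x : ℝ, P.real {ω | (X ω : ℝ) ≤ x} = F x
  dispersion_mem : ∃ l ∈ E.index, σ₀sq = l⁻¹
  mean_mem : ∀ n : ℕ, 1 ≤ n → P (X ⁻¹' {n}) ≠ 0 → μ n ∈ deriv E.cumulant '' E.canonical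
  independent : ∀ n : ℕ, 1 ≤ n → P (X ⁻¹' {n}) ≠ 0 →
    iIndepFun (fun i : Fin n => Y i) (P[|X ⁻¹' {n}])
  severity : ∀ n : ℕ, 1 ≤ n → P (X ⁻¹' {n}) ≠ 0 → ∀ i : Fin n,
    HasLaw (Y i) (E.law (μ n) σ₀sq) (P[|X ⁻¹' {n}])

/-! ### Conditional distributions given the value of a continuous variable -/

/-- `κ z` is the conditional distribution of `W` given `V = z`, for every real `z`: `κ` is a regular
conditional distribution of `W` given `V` and depends weakly continuously on `z`, which pins down
`κ z` for every `z` in the support of the law of `V`. -/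
structure IsContinuousCondDistrib {E : Type*} [TopologicalSpace E] [MeasurableSpace E]
    (W : Ω → E) (V : Ω → ℝ) (κ : Kernel ℝ E) (P : Measure Ω) : Prop where
  isMarkovKernel : IsMarkovKernel κ
  hasCondDistrib : HasCondDistrib W V κ P
  continuous : ∀ f : BoundedContinuousFunction E ℝ, Continuous fun z => ∫ w, f w ∂(κ z)

end CRM

end

/-!
Let `R = corrMatrix n ρ₁ ρ₂` and let `A = Σ_{ρ₂} - ρ₁² J` be the Schur complement of its upper left
entry. Completing the square gives
`(z, x)ᵀ R⁻¹ (z, x) = z² + (x - ρ₁ z 1)ᵀ A⁻¹ (x - ρ₁ z 1)` (`quadForm_inv_corrMatrix`), and row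
reduction gives `det R = det A` (`det_corrMatrix`). So, for every real `z` and not just for almost
every one, the section `c(Φ(z), ·)` of the Gaussian copula density is the density on the cube of
`(Φ(X_1), …, Φ(X_n))` with `X ∼ N(ρ₁ z 1, A)` (`map_Phi_conditional`).

The map `⌈·⌉_{α,F}` is constant, equal to `F_α(n)`, on `(F(n-1), F(n)]`. Hence the increment of the
transformed copula over this interval is `P(N = n)` times the integral of the section at `F_α(n)`
(`transformedCopula_sub`). With `q = Φ⁻¹(F_α(n))` and `G(y) = Φ((y - ξ) / σ)`, the conditional
distribution function of the severities at `y` is therefore `P(ξ + σ X_i ≤ y_i for all i)` with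
`X ∼ N(ρ₁ q 1, A)`, and distribution functions determine laws
(`TransformedCopulaCRM.hasLaw_severities`).

For the comparison with a normal vector `(Z_0, …, Z_n)`, characteristic functions show that it has
the law of `(z, (ξ + σ ρ₁ z) 1 + x)` with independent `z ∼ N(0, 1)` and `x ∼ N(0, σ² A)`
(`multivariateGaussian_scaled_corrMatrix`). The translates of `N(0, σ² A)` thus form a conditional
distribution, weakly continuous in `z`; any other continuous version agrees with it almost
everywhere, hence everywhere (`IsContinuousCondDistrib.eq_of_hasLaw_gaussianReal`).

If `ρ₂ = ρ₁²`, then `A = (1 - ρ₁²) I`, so the severities are conditionally independent with the laws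
of the two-part model. The frequencies agree as well, and so do the laws of the vectors of random
length (`identDistrib_crmVector`).
-/

namespace CRM

/-! ### The Schur complement of the exchangeable correlation matrix -/

/-- The Schur complement `Σ_{ρ₂} - ρ₁² J` of the upper left entry of `corrMatrix n ρ₁ ρ₂`. It is the
covariance matrix of the last `n` coordinates, conditionally on the first, of a normal vector with
covariance matrix `corrMatrix n ρ₁ ρ₂`. -/
def condCov (n : ℕ) (ρ₁ ρ₂ : ℝ) : Matrix (Fin n) (Fin n) ℝ :=
  exchMatrix n ρ₂ - ρ₁ ^ 2 • onesMatrix n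

lemma condCov_apply (n : ℕ) (ρ₁ ρ₂ : ℝ) (i j : Fin n) :
    condCov n ρ₁ ρ₂ i j = (if i = j then 1 else ρ₂) - ρ₁ ^ 2 := by
  simp [condCov, exchMatrix, onesMatrix]

lemma condCov_posDef (n : ℕ) {ρ₁ ρ₂ : ℝ} (h₁ : ρ₁ ^ 2 ≤ ρ₂) (h₂ : ρ₂ < 1) :
    (condCov n ρ₁ ρ₂).PosDef := by
  have h : condCov n ρ₁ ρ₂ = (1 - ρ₂) • (1 : Matrix (Fin n) (Fin n) ℝ) +
      (ρ₂ - ρ₁ ^ 2) • Matrix.vecMulVec (fun _ => 1) (star fun _ => 1) := by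
    ext i j
    by_cases hij : i = j <;> simp [condCov_apply, Matrix.vecMulVec_apply, hij]
  rw [h]
  exact (Matrix.PosDef.one.smul (sub_pos.2 h₂)).add_posSemidef
    ((Matrix.posSemidef_vecMulVec_self_star _).smul (sub_nonneg.2 h₁))

lemma corrMatrix_mulVec_cons (n : ℕ) (ρ₁ ρ₂ z : ℝ) (w : Fin n → ℝ) :
    corrMatrix n ρ₁ ρ₂ *ᵥ (Fin.cons z w) =
      Fin.cons (z + ρ₁ * ∑ i, w i) ((exchMatrix n ρ₂ *ᵥ w) + fun _ => ρ₁ * z) := by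
  ext i
  refine Fin.cases ?_ (fun i => ?_) i <;>
    simp [Matrix.mulVec, dotProduct, Fin.sum_univ_succ, corrMatrix, Finset.mul_sum, add_comm]

lemma condCov_mulVec (n : ℕ) (ρ₁ ρ₂ : ℝ) (w : Fin n → ℝ) :
    condCov n ρ₁ ρ₂ *ᵥ w = (exchMatrix n ρ₂ *ᵥ w) - fun _ => ρ₁ ^ 2 * ∑ i, w i := by
  rw [condCov, Matrix.sub_mulVec, Matrix.smul_mulVec]
  congr 1
  ext i
  simp [Matrix.mulVec, dotProduct, onesMatrix]

lemma det_corrMatrix (n : ℕ) (ρ₁ ρ₂ : ℝ) :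
    (corrMatrix n ρ₁ ρ₂).det = (condCov n ρ₁ ρ₂).det := by
  set B : Matrix (Fin (n + 1)) (Fin (n + 1)) ℝ :=
    Matrix.of (Fin.cons (Fin.cons 1 fun _ => ρ₁) fun i => Fin.cons 0 fun j => condCov n ρ₁ ρ₂ i j)
    with hB
  -- subtracting `ρ₁` times the first row from all others makes the matrix block triangular
  have h : (corrMatrix n ρ₁ ρ₂).det = B.det := by
    refine Matrix.det_eq_of_forall_row_eq_smul_add_const (Fin.cons 0 fun _ => ρ₁) 0 rfl ?_
    intro i j
    refine Fin.cases ?_ (fun i => ?_) i <;> refine Fin.cases ?_ (fun j => ?_) j <;>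
      simp [hB, corrMatrix, condCov, onesMatrix]
    ring
  rw [h, Matrix.det_succ_column_zero, Fin.sum_univ_succ]
  have h0 : B.submatrix Fin.succ Fin.succ = condCov n ρ₁ ρ₂ := by
    ext i j; simp [hB]
  simp [hB] at h0 ⊢
  exact congrArg Matrix.det h0

/-- Completing the square in the quadratic form of `(corrMatrix n ρ₁ ρ₂)⁻¹`. -/
lemma quadForm_inv_corrMatrix (n : ℕ) {ρ₁ ρ₂ : ℝ} (h₁ : ρ₁ ^ 2 ≤ ρ₂) (h₂ : ρ₂ < 1) (z : ℝ)
    (x : Fin n → ℝ) :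
    (Fin.cons z x : Fin (n + 1) → ℝ) ⬝ᵥ ((corrMatrix n ρ₁ ρ₂)⁻¹ *ᵥ Fin.cons z x) =
      z ^ 2 + (x - fun _ => ρ₁ * z) ⬝ᵥ ((condCov n ρ₁ ρ₂)⁻¹ *ᵥ (x - fun _ => ρ₁ * z)) := by
  set w := (condCov n ρ₁ ρ₂)⁻¹ *ᵥ (x - fun _ => ρ₁ * z) with hw
  have hR : IsUnit (corrMatrix n ρ₁ ρ₂).det := (corrMatrix_posDef n h₁ h₂).det_pos.ne'.isUnit
  have hA : IsUnit (condCov n ρ₁ ρ₂).det := (condCov_posDef n h₁ h₂).det_pos.ne'.isUnit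
  have hAw : condCov n ρ₁ ρ₂ *ᵥ w = x - fun _ => ρ₁ * z := by
    rw [hw, Matrix.mulVec_mulVec, Matrix.mul_nonsing_inv _ hA, Matrix.one_mulVec]
  -- block elimination: the solution of `R (a, w) = (z, x)` is `w = A⁻¹ (x - ρ₁ z 1)`,
  -- `a = z - ρ₁ ∑ w`
  have hRw : corrMatrix n ρ₁ ρ₂ *ᵥ Fin.cons (z - ρ₁ * ∑ i, w i) w = Fin.cons z x := by
    rw [corrMatrix_mulVec_cons]
    rw [condCov_mulVec] at hAw
    ext i
    refine Fin.cases ?_ (fun i => ?_) i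
    · simp
    · have := congrFun hAw i
      simp only [Pi.sub_apply] at this
      simp only [Fin.cons_succ, Pi.add_apply]
      linarith
  have hinv : (corrMatrix n ρ₁ ρ₂)⁻¹ *ᵥ Fin.cons z x = Fin.cons (z - ρ₁ * ∑ i, w i) w := by
    rw [← hRw, Matrix.mulVec_mulVec, Matrix.nonsing_inv_mul _ hR, Matrix.one_mulVec]
  rw [hinv, sub_dotProduct]
  simp only [dotProduct, Fin.sum_univ_succ, Fin.cons_zero, Fin.cons_succ, ← Finset.mul_sum]
  ring

/-! ### Sections of the density of the Gaussian copula -/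

lemma measurable_Phi_comp (d : ℕ) : Measurable fun (z : Fin d → ℝ) (i : Fin d) => Phi (z i) :=
  measurable_pi_lambda _ fun i => continuous_Phi.measurable.comp (measurable_pi_apply i)

lemma measurable_prod_gaussianPDFReal (d : ℕ) :
    Measurable fun x : Fin d → ℝ => ENNReal.ofReal (∏ i, gaussianPDFReal 0 1 (x i)) := by
  have h (i : Fin d) : Measurable fun u : Fin d → ℝ => gaussianPDFReal 0 1 (u i) :=
    (measurable_gaussianPDFReal 0 1).comp (measurable_pi_apply i)
  fun_prop

lemma measurable_finCons {X : Type*} [MeasurableSpace X] {d : ℕ} {f : X → ℝ} {g : X → Fin d → ℝ}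
    (hf : Measurable f) (hg : Measurable g) :
    Measurable fun x => (Fin.cons (f x) (g x) : Fin (d + 1) → ℝ) := by
  refine measurable_pi_lambda _ fun i => ?_
  refine Fin.cases ?_ (fun i => ?_) i
  · simpa using hf
  · simpa [Function.comp_def] using (measurable_pi_apply i).comp hg

lemma multivariateGaussian_map_affine {ι : Type*} [Fintype ι] [DecidableEq ι]
    {S : Matrix ι ι ℝ} (hS : S.PosSemidef) (μ m : EuclideanSpace ℝ ι) (c : ℝ) :
    (multivariateGaussian μ S).map (fun x => m + c • x) =
      multivariateGaussian (m + c • μ) (c ^ 2 • S) := by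
  have h : (fun x : EuclideanSpace ℝ ι => m + c • x) = (fun x => m + x) ∘ (fun x => c • x) := rfl
  have : IsProbabilityMeasure ((multivariateGaussian μ S).map (fun x => m + c • x)) :=
    Measure.isProbabilityMeasure_map (by fun_prop)
  refine Measure.ext_of_charFun ?_
  ext t
  rw [h, ← Measure.map_map (by fun_prop) (by fun_prop), charFun_map_const_add, charFun_map_smul,
    charFun_multivariateGaussian hS,
    charFun_multivariateGaussian (hS.smul (sq_nonneg c)), ← Complex.exp_add]
  congr 1
  simp only [WithLp.ofLp_smul, Matrix.mulVec_smul, Matrix.smul_mulVec, smul_dotProduct,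
    dotProduct_smul, inner_add_right, real_inner_smul_left, real_inner_smul_right,
    real_inner_comm t m, smul_eq_mul]
  push_cast
  ring

/-- The density of the normal law with covariance matrix `S` and arbitrary mean, expressed through
the Gaussian copula density. -/
lemma multivariateGaussian_map_ofLp_eq_withDensity {d : ℕ} {S : Matrix (Fin d) (Fin d) ℝ}
    (hS : S.PosDef) (m : EuclideanSpace ℝ (Fin d)) :
    (multivariateGaussian m S).map (fun z : EuclideanSpace ℝ (Fin d) => (fun i => z i)) =
      (volume : Measure (Fin d → ℝ)).withDensity fun x =>
        ENNReal.ofReal (∏ i, gaussianPDFReal 0 1 (x i - m i)) *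
          ENNReal.ofReal (gaussianCopulaDensity S fun i => Phi (x i - m i)) := by
  have hc : Measurable fun z : Fin d → ℝ =>
      ENNReal.ofReal (gaussianCopulaDensity S (fun i => Phi (z i))) :=
    ENNReal.measurable_ofReal.comp
      ((measurable_gaussianCopulaDensity S).comp (measurable_Phi_comp d))
  have h0 : multivariateGaussian m S =
      (multivariateGaussian 0 S).map (fun x => m + (1 : ℝ) • x) := by
    rw [multivariateGaussian_map_affine hS.posSemidef]; simp
  have h1 : (fun z : EuclideanSpace ℝ (Fin d) => (fun i => z i)) ∘
        (fun x : EuclideanSpace ℝ (Fin d) => m + (1 : ℝ) • x) =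
      (fun x : Fin d → ℝ => x + fun i => m i) ∘
        (fun z : EuclideanSpace ℝ (Fin d) => (fun i => z i)) := by
    ext x i; simp [add_comm]
  rw [h0, Measure.map_map (by fun_prop) (by fun_prop), h1,
    ← Measure.map_map (by fun_prop) (by fun_prop), multivariateGaussian_map_ofLp hS,
    pi_gaussian_eq, ← withDensity_mul _ (measurable_prod_gaussianPDFReal d) hc]
  ext s hs
  rw [Measure.map_apply (by fun_prop) hs, withDensity_apply _ (by measurability),
    withDensity_apply _ hs, ← lintegral_indicator (by measurability), ← lintegral_indicator hs,
    ← lintegral_add_right_eq_self (s.indicator _) (fun i => m i)]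
  refine lintegral_congr fun x => ?_
  simp only [indicator, mem_preimage, Pi.add_apply, add_sub_cancel_right]
  rfl

/-- The joint density of the normal vector with covariance matrix `corrMatrix n ρ₁ ρ₂` at `(z, x)`,
divided by the density of its first coordinate at `z`, is the density of `N(ρ₁ z 1, A)` at `x`, where
`A = condCov n ρ₁ ρ₂`. -/
lemma gaussianCopulaDensity_corrMatrix_cons (n : ℕ) {ρ₁ ρ₂ : ℝ} (h₁ : ρ₁ ^ 2 ≤ ρ₂) (h₂ : ρ₂ < 1)
    (z : ℝ) (x : Fin n → ℝ) :
    (∏ i, gaussianPDFReal 0 1 (x i)) *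
        gaussianCopulaDensity (corrMatrix n ρ₁ ρ₂) (Fin.cons (Phi z) fun i => Phi (x i)) =
      (∏ i, gaussianPDFReal 0 1 (x i - ρ₁ * z)) *
        gaussianCopulaDensity (condCov n ρ₁ ρ₂) fun i => Phi (x i - ρ₁ * z) := by
  have h0 : (fun i => invPhi ((Fin.cons (Phi z) fun i => Phi (x i) : Fin (n + 1) → ℝ) i)) =
      Fin.cons z x := by
    ext i; refine Fin.cases ?_ (fun i => ?_) i <;> simp [invPhi_Phi]
  have h3 : (Fin.cons z x : Fin (n + 1) → ℝ) ⬝ᵥ Fin.cons z x = z ^ 2 + x ⬝ᵥ x := by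
    simp [dotProduct, Fin.sum_univ_succ, sq]
  have h4 : (fun i => x i - ρ₁ * z) = x - fun _ => ρ₁ * z := rfl
  unfold gaussianCopulaDensity
  rw [h0, prod_gaussianPDFReal, prod_gaussianPDFReal, det_corrMatrix, Matrix.sub_mulVec,
    dotProduct_sub, Matrix.one_mulVec, quadForm_inv_corrMatrix n h₁ h₂, h3]
  simp only [invPhi_Phi]
  rw [Matrix.sub_mulVec, dotProduct_sub, Matrix.one_mulVec, h4]
  set Q := (x - fun _ => ρ₁ * z) ⬝ᵥ ((condCov n ρ₁ ρ₂)⁻¹ *ᵥ (x - fun _ => ρ₁ * z))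
  set S := (x - fun _ => ρ₁ * z) ⬝ᵥ (x - fun _ => ρ₁ * z)
  have h5 : Real.exp (-(x ⬝ᵥ x) / 2) * Real.exp (-(z ^ 2 + Q - (z ^ 2 + x ⬝ᵥ x)) / 2) =
      Real.exp (-S / 2) * Real.exp (-(Q - S) / 2) := by
    rw [← Real.exp_add, ← Real.exp_add]; congr 1; ring
  linear_combination ((Real.sqrt (2 * Real.pi))⁻¹) ^ n * (Real.sqrt (condCov n ρ₁ ρ₂).det)⁻¹ * h5

/-- The multivariate probability integral transform. -/
lemma map_Phi_pi (d : ℕ) : (Measure.pi (fun _ : Fin d => gaussianReal 0 1)).map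
      (fun (z : Fin d → ℝ) (i : Fin d) => Phi (z i)) =
    (volume : Measure (Fin d → ℝ)).restrict (Icc 0 1) := by
  have : ∀ i : Fin d, SigmaFinite ((gaussianReal 0 1).map Phi) := by
    intro i; rw [map_Phi]; infer_instance
  rw [Measure.pi_map_pi (fun _ => continuous_Phi.measurable.aemeasurable)]
  simp only [map_Phi]
  rw [← Measure.restrict_pi_pi, ← volume_pi, Set.pi_univ_Icc]
  rfl

/-- The section at `Φ(z)` of the Gaussian copula density with matrix `corrMatrix n ρ₁ ρ₂` is a
probability density on the cube: it belongs to `(Φ(X_1), …, Φ(X_n))`, where `X` follows the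
conditional law of the last `n` coordinates of the normal vector given that the first one is `z`. -/
lemma map_Phi_conditional (n : ℕ) {ρ₁ ρ₂ : ℝ} (h₁ : ρ₁ ^ 2 ≤ ρ₂) (h₂ : ρ₂ < 1) (z : ℝ) :
    (multivariateGaussian (WithLp.toLp 2 fun _ : Fin n => ρ₁ * z) (condCov n ρ₁ ρ₂)).map
        (fun x : EuclideanSpace ℝ (Fin n) => (fun i => Phi (x i))) =
      ((volume : Measure (Fin n → ℝ)).restrict (Icc 0 1)).withDensity fun u =>
        ENNReal.ofReal (gaussianCopulaDensity (corrMatrix n ρ₁ ρ₂) (Fin.cons (Phi z) u)) := by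
  have hPhi := measurable_Phi_comp n
  have hc : Measurable fun u : Fin n → ℝ =>
      ENNReal.ofReal (gaussianCopulaDensity (corrMatrix n ρ₁ ρ₂) (Fin.cons (Phi z) u)) :=
    ENNReal.measurable_ofReal.comp ((measurable_gaussianCopulaDensity _).comp
      (measurable_finCons measurable_const measurable_id))
  have hc' : Measurable fun x : Fin n → ℝ => ENNReal.ofReal (gaussianCopulaDensity
      (corrMatrix n ρ₁ ρ₂) (Fin.cons (Phi z) fun i => Phi (x i))) := hc.comp hPhi
  have h1 : (fun z : EuclideanSpace ℝ (Fin n) => (fun i => Phi (z i))) =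
      (fun (z : Fin n → ℝ) (i : Fin n) => Phi (z i)) ∘
        (fun z : EuclideanSpace ℝ (Fin n) => (fun i => z i)) := rfl
  have h2 : (fun x : Fin n → ℝ =>
      ENNReal.ofReal (∏ i, gaussianPDFReal 0 1 (x i - ρ₁ * z)) *
        ENNReal.ofReal (gaussianCopulaDensity (condCov n ρ₁ ρ₂) fun i => Phi (x i - ρ₁ * z))) =
      (fun x => ENNReal.ofReal (∏ i, gaussianPDFReal 0 1 (x i))) *
        fun x => ENNReal.ofReal (gaussianCopulaDensity (corrMatrix n ρ₁ ρ₂)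
          (Fin.cons (Phi z) fun i => Phi (x i))) := by
    ext x
    rw [Pi.mul_apply, ← ENNReal.ofReal_mul (Finset.prod_nonneg fun i _ =>
      gaussianPDFReal_nonneg _ _ _), ← ENNReal.ofReal_mul (Finset.prod_nonneg fun i _ =>
      gaussianPDFReal_nonneg _ _ _), gaussianCopulaDensity_corrMatrix_cons n h₁ h₂]
  rw [h1, ← Measure.map_map hPhi (by fun_prop),
    multivariateGaussian_map_ofLp_eq_withDensity (condCov_posDef n h₁ h₂), h2,
    withDensity_mul _ (measurable_prod_gaussianPDFReal n) hc', ← pi_gaussian_eq, ← map_Phi_pi]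
  ext s hs
  rw [Measure.map_apply hPhi hs, withDensity_apply _ (hPhi hs), withDensity_apply _ hs,
    setLIntegral_map hs hc hPhi]

/-- Over `[0, v]`, the section of the Gaussian copula density at `q ∈ (0,1)` is integrable, and its
integral is a value of the distribution function of `(Φ(X_1), …, Φ(X_n))` for a normal vector `X`. -/
lemma integrableOn_section_and_integral (n : ℕ) {ρ₁ ρ₂ : ℝ} (h₁ : ρ₁ ^ 2 ≤ ρ₂) (h₂ : ρ₂ < 1)
    {q : ℝ} (hq : q ∈ Ioo (0 : ℝ) 1) {v : Fin n → ℝ} (hv : v ≤ 1) :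
    IntegrableOn (fun t => (exchGaussianCopula h₁ h₂ n).density (Fin.cons q t)) (Icc 0 v) ∧
    ∫ t in Icc 0 v, (exchGaussianCopula h₁ h₂ n).density (Fin.cons q t) =
      (multivariateGaussian (WithLp.toLp 2 fun _ : Fin n => ρ₁ * invPhi q)
        (condCov n ρ₁ ρ₂)).real {x | ∀ i, Phi (x i) ≤ v i} := by
  obtain ⟨z, rfl⟩ := exists_Phi_eq hq
  rw [invPhi_Phi]
  have hPhi : Measurable fun z : EuclideanSpace ℝ (Fin n) => (fun i => Phi (z i)) :=
    measurable_pi_lambda _ fun i => continuous_Phi.measurable.comp (by fun_prop)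
  have hc : Measurable fun t : Fin n → ℝ =>
      (exchGaussianCopula h₁ h₂ n).density (Fin.cons (Phi z) t) :=
    (exchGaussianCopula h₁ h₂ n).measurable_density.comp
      (measurable_finCons measurable_const measurable_id)
  have hset : {x : EuclideanSpace ℝ (Fin n) | ∀ i, Phi (x i) ≤ v i} =
      (fun x : EuclideanSpace ℝ (Fin n) => (fun i => Phi (x i))) ⁻¹' Icc 0 v := by
    ext x
    exact ⟨fun h => ⟨fun i => (Phi_mem _).1.le, h⟩, fun h => h.2⟩
  have hlint : ∫⁻ t in Icc 0 v,
        ENNReal.ofReal ((exchGaussianCopula h₁ h₂ n).density (Fin.cons (Phi z) t)) =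
      multivariateGaussian (WithLp.toLp 2 fun _ : Fin n => ρ₁ * z) (condCov n ρ₁ ρ₂)
        {x | ∀ i, Phi (x i) ≤ v i} := by
    rw [hset, ← Measure.map_apply hPhi measurableSet_Icc, map_Phi_conditional n h₁ h₂,
      withDensity_apply _ measurableSet_Icc, Measure.restrict_restrict measurableSet_Icc,
      inter_eq_left.2 (Icc_subset_Icc le_rfl hv)]
    rfl
  refine ⟨⟨hc.aestronglyMeasurable, ?_⟩, ?_⟩
  · rw [hasFiniteIntegral_iff_ofReal
      (ae_of_all _ fun t => (exchGaussianCopula h₁ h₂ n).density_nonneg _), hlint]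
    exact measure_lt_top _ _
  · rw [integral_eq_lintegral_of_nonneg_ae
      (ae_of_all _ fun t => (exchGaussianCopula h₁ h₂ n).density_nonneg _)
      hc.aestronglyMeasurable, hlint, measureReal_def]

/-! ### Increments of the transformed copula -/

section Increments

variable {α : ℝ} {F : ℝ → ℝ}

lemma ceilMap_of_mem (hF : Monotone F) (k : ℕ) {u : ℝ} (hu : u ∈ Ioc (F ((k : ℝ) - 1)) (F k)) :
    ceilMap α F u = Falpha α F k := by
  have h (j : ℕ) (hj : j ≠ k) :
      (Ioc (F ((j : ℝ) - 1)) (F j)).indicator (fun _ => Falpha α F j) u = 0 := by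
    refine indicator_of_notMem (fun hu' => ?_) _
    rcases lt_or_gt_of_ne hj with hjk | hjk
    · have : (j : ℝ) ≤ (k : ℝ) - 1 := by
        have : ((j + 1 : ℕ) : ℝ) ≤ k := by exact_mod_cast hjk
        push_cast at this; linarith
      exact absurd (hu'.2.trans (hF this)) (not_le.2 hu.1)
    · have : (k : ℝ) ≤ (j : ℝ) - 1 := by
        have : ((k + 1 : ℕ) : ℝ) ≤ j := by exact_mod_cast hjk
        push_cast at this; linarith
      exact absurd (hu.2.trans (hF this)) (not_le.2 hu'.1)
  rw [ceilMap, tsum_eq_single k h, indicator_of_mem hu]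

lemma Falpha_mem_Ioo (hα : α ∈ Ioo (0 : ℝ) 1) (hF0 : ∀ x, 0 ≤ F x) (hF1 : ∀ x, F x ≤ 1) {k : ℕ}
    (hk : F ((k : ℝ) - 1) < F k) : Falpha α F k ∈ Ioo (0 : ℝ) 1 := by
  obtain ⟨ha, hb⟩ := hα
  have h0 := hF0 ((k : ℝ) - 1)
  have h1 := hF1 k
  constructor <;> simp only [Falpha] <;> nlinarith

/-- Over the slab where the first coordinate lies in `(F(k-1), F(k)]` the transformed density
does not depend on that coordinate. -/
lemma transformedDensity_slab (hF : Monotone F) {d : ℕ} (C : AbsContCopula (d + 1)) (k : ℕ)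
    (v : Fin d → ℝ)
    (hint : F ((k : ℝ) - 1) < F k →
      IntegrableOn (fun t => C.density (Fin.cons (Falpha α F k) t)) (Icc 0 v)) :
    IntegrableOn (transformedDensity α F C)
      {t : Fin (d + 1) → ℝ | t 0 ∈ Ioc (F ((k : ℝ) - 1)) (F k) ∧ Fin.tail t ∈ Icc 0 v} ∧
    ∫ t in {t : Fin (d + 1) → ℝ | t 0 ∈ Ioc (F ((k : ℝ) - 1)) (F k) ∧ Fin.tail t ∈ Icc 0 v},
        transformedDensity α F C t =
      (F k - F ((k : ℝ) - 1)) * ∫ t in Icc 0 v, C.density (Fin.cons (Falpha α F k) t) := by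
  set e := MeasurableEquiv.piFinSuccAbove (fun _ : Fin (d + 1) => ℝ) 0 with he
  have hmp : MeasurePreserving e volume volume :=
    volume_preserving_piFinSuccAbove (fun _ : Fin (d + 1) => ℝ) 0
  set g : (Fin d → ℝ) → ℝ := fun t => C.density (Fin.cons (Falpha α F k) t) with hg
  have hset : {t : Fin (d + 1) → ℝ | t 0 ∈ Ioc (F ((k : ℝ) - 1)) (F k) ∧ Fin.tail t ∈ Icc 0 v} =
      e ⁻¹' (Ioc (F ((k : ℝ) - 1)) (F k) ×ˢ Icc 0 v) := by
    ext t; rfl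
  have hmeas : MeasurableSet (e ⁻¹' (Ioc (F ((k : ℝ) - 1)) (F k) ×ˢ Icc 0 v)) :=
    e.measurable (measurableSet_Ioc.prod measurableSet_Icc)
  have hEq : EqOn (transformedDensity α F C) (fun t => 1 * g (e t).2)
      (e ⁻¹' (Ioc (F ((k : ℝ) - 1)) (F k) ×ˢ Icc 0 v)) := by
    intro t ht
    have h : ceilMap α F (t 0) = Falpha α F k := ceilMap_of_mem hF k ht.1
    simp only [one_mul, transformedDensity, h]
    rfl
  rw [hset]
  constructor
  · rw [integrableOn_congr_fun hEq hmeas]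
    change IntegrableOn ((fun p : ℝ × (Fin d → ℝ) => 1 * g p.2) ∘ e) _ _
    rw [hmp.integrableOn_comp_preimage e.measurableEmbedding]
    rcases lt_or_ge (F ((k : ℝ) - 1)) (F k) with h | h
    · rw [IntegrableOn, Measure.volume_eq_prod, ← Measure.prod_restrict]
      exact (integrable_const (1 : ℝ)).mul_prod (hint h)
    · rw [Ioc_eq_empty (not_lt.2 h), empty_prod]
      exact integrableOn_empty
  · rw [setIntegral_congr_fun hmeas hEq,
      hmp.setIntegral_preimage_emb e.measurableEmbedding
        (fun p : ℝ × (Fin d → ℝ) => 1 * g p.2), Measure.volume_eq_prod,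
      setIntegral_prod_mul (fun _ => (1 : ℝ)) g]
    have hle : F ((k : ℝ) - 1) ≤ F k := hF (by linarith)
    simp [hle]

lemma Icc_cons_eq_union (hF : Monotone F) (hF0 : ∀ x, 0 ≤ F x) {d : ℕ} (k : ℕ) (v : Fin d → ℝ) :
    Icc (0 : Fin (d + 1) → ℝ) (Fin.cons (F k) v) =
      Icc 0 (Fin.cons (F ((k : ℝ) - 1)) v) ∪
        {t : Fin (d + 1) → ℝ | t 0 ∈ Ioc (F ((k : ℝ) - 1)) (F k) ∧ Fin.tail t ∈ Icc 0 v} := by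
  have hle : F ((k : ℝ) - 1) ≤ F k := hF (by linarith)
  have h0 := hF0 ((k : ℝ) - 1)
  ext t
  simp only [mem_Icc, Pi.le_def, mem_union, mem_ofPred_eq, Fin.forall_fin_succ, Fin.cons_zero,
    Fin.cons_succ, Pi.zero_apply, mem_Ioc, Fin.tail]
  constructor
  · rintro ⟨⟨a, b⟩, c, d⟩
    rcases le_or_gt (t 0) (F ((k : ℝ) - 1)) with h | h
    · exact Or.inl ⟨⟨a, b⟩, h, d⟩
    · exact Or.inr ⟨⟨h, c⟩, b, d⟩
  · rintro (⟨⟨a, b⟩, c, d⟩ | ⟨⟨a, b⟩, c, d⟩)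
    · exact ⟨⟨a, b⟩, c.trans hle, d⟩
    · exact ⟨⟨h0.trans a.le, c⟩, b, d⟩

/-- Integrability on the boxes below the levels `F(k-1)`, without which the increments of the
transformed copula could not be computed as integrals over slabs: each such box is a union of `k`
slabs, up to a null set. -/
lemma integrableOn_transformedDensity (hF : Monotone F) (hF0 : ∀ x, 0 ≤ F x) (hFneg : F (-1) = 0)
    {d : ℕ} (C : AbsContCopula (d + 1)) (v : Fin d → ℝ)
    (hint : ∀ k : ℕ, F ((k : ℝ) - 1) < F k →
      IntegrableOn (fun t => C.density (Fin.cons (Falpha α F k) t)) (Icc 0 v)) (k : ℕ) :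
    IntegrableOn (transformedDensity α F C)
      (Icc (0 : Fin (d + 1) → ℝ) (Fin.cons (F ((k : ℝ) - 1)) v)) := by
  induction k with
  | zero =>
    -- `F (-1) = 0`, so the box is flat and has measure zero
    have h : volume (Icc (0 : Fin (d + 1) → ℝ) (Fin.cons (F (((0 : ℕ) : ℝ) - 1)) v)) = 0 := by
      rw [Real.volume_Icc_pi, Fin.prod_univ_succ]
      simp [hFneg]
    rw [IntegrableOn, Measure.restrict_eq_zero.2 h]
    exact integrable_zero_measure
  | succ k ih =>
    have h : (((k + 1 : ℕ) : ℝ) - 1) = k := by push_cast; ring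
    rw [h, Icc_cons_eq_union hF hF0]
    exact ih.union (transformedDensity_slab hF C k v (hint k)).1

lemma transformedCopula_sub (hF : Monotone F) (hF0 : ∀ x, 0 ≤ F x) (hFneg : F (-1) = 0)
    {d : ℕ} (C : AbsContCopula (d + 1)) (v : Fin d → ℝ)
    (hint : ∀ k : ℕ, F ((k : ℝ) - 1) < F k →
      IntegrableOn (fun t => C.density (Fin.cons (Falpha α F k) t)) (Icc 0 v)) (k : ℕ) :
    transformedCopula α F C (F k) v - transformedCopula α F C (F ((k : ℝ) - 1)) v =
      (F k - F ((k : ℝ) - 1)) * ∫ t in Icc 0 v, C.density (Fin.cons (Falpha α F k) t) := by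
  obtain ⟨hi, hv⟩ := transformedDensity_slab hF C k v (hint k)
  have hmeas : MeasurableSet
      {t : Fin (d + 1) → ℝ | t 0 ∈ Ioc (F ((k : ℝ) - 1)) (F k) ∧ Fin.tail t ∈ Icc 0 v} :=
    (MeasurableEquiv.piFinSuccAbove (fun _ : Fin (d + 1) => ℝ) 0).measurable
      (measurableSet_Ioc.prod measurableSet_Icc)
  have hdisj : Disjoint (Icc (0 : Fin (d + 1) → ℝ) (Fin.cons (F ((k : ℝ) - 1)) v))
      {t : Fin (d + 1) → ℝ | t 0 ∈ Ioc (F ((k : ℝ) - 1)) (F k) ∧ Fin.tail t ∈ Icc 0 v} :=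
    disjoint_left.2 fun t ht ht' => absurd (ht.2 0) (not_le.2 ht'.1.1)
  rw [transformedCopula, transformedCopula, Icc_cons_eq_union hF hF0, setIntegral_union hdisj hmeas
    (integrableOn_transformedDensity hF hF0 hFneg C v hint k) hi, hv]
  ring

end Increments

/-! ### The conditional law of the severities -/

lemma gaussianReal_eq_map_affine (ξ σ : ℝ) :
    gaussianReal ξ (σ ^ 2).toNNReal = (gaussianReal 0 1).map fun x => ξ + σ * x := by
  have h : (fun x : ℝ => ξ + σ * x) = (fun x => ξ + x) ∘ (fun x => σ * x) := rfl
  rw [h, ← Measure.map_map (by fun_prop) (by fun_prop), gaussianReal_map_const_mul,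
    gaussianReal_map_const_add]
  congr 1
  · simp
  · ext; simp [sq_nonneg]

lemma normalCDF_eq_Phi (ξ : ℝ) {σ : ℝ} (hσ : 0 < σ) (x : ℝ) :
    normalCDF ξ σ x = Phi ((x - ξ) / σ) := by
  rw [normalCDF, cdf_eq_real, Phi_eq, gaussianReal_eq_map_affine, map_measureReal_apply
    (by fun_prop) measurableSet_Iic]
  congr 1
  ext y
  simp only [mem_preimage, mem_Iic, le_div_iff₀ hσ]
  constructor <;> intro h <;> linarith

lemma ext_of_lower_orthants {n : ℕ} {μ ν : Measure (Fin n → ℝ)} [IsProbabilityMeasure μ]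
    [IsProbabilityMeasure ν]
    (h : ∀ y : Fin n → ℝ, μ.real {x | ∀ i, x i ≤ y i} = ν.real {x | ∀ i, x i ≤ y i}) : μ = ν := by
  have hspan : IsCountablySpanning (range (Iic : ℝ → Set ℝ)) :=
    ⟨fun k : ℕ => Iic (k : ℝ), fun k => mem_range_self _, by
      ext x; simpa using exists_nat_ge x⟩
  have hgen : (inferInstance : MeasurableSpace (Fin n → ℝ)) =
      MeasurableSpace.generateFrom (univ.pi '' univ.pi fun _ : Fin n => range (Iic : ℝ → Set ℝ)) := by
    rw [← generateFrom_pi_eq fun _ => hspan, ← borel_eq_generateFrom_Iic ℝ,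
      ← BorelSpace.measurable_eq]
  refine ext_of_generate_finite _ hgen (IsPiSystem.pi fun _ => isPiSystem_Iic) ?_ (by simp)
  rintro _ ⟨s, hs, rfl⟩
  have hs' : ∀ i, ∃ y, Iic y = s i := fun i => hs i (mem_univ i)
  choose y hy using hs'
  have : univ.pi s = {x | ∀ i, x i ≤ y i} := by
    ext x; simp [← hy]
  rw [this]
  exact (measureReal_eq_measureReal_iff).1 (h y)

section Frequency

variable {Ω : Type*} [MeasurableSpace Ω] {P : Measure Ω} {N : Ω → ℕ}
  {F : ℝ → ℝ}

lemma nonneg_of_frequency (h : ∀ x : ℝ, P.real {ω | (N ω : ℝ) ≤ x} = F x) (x : ℝ) : 0 ≤ F x := by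
  rw [← h]; exact measureReal_nonneg

lemma neg_one_of_frequency (h : ∀ x : ℝ, P.real {ω | (N ω : ℝ) ≤ x} = F x) : F (-1) = 0 := by
  rw [← h]
  have : {ω | (N ω : ℝ) ≤ -1} = ∅ := by
    ext ω
    have : (0 : ℝ) ≤ N ω := Nat.cast_nonneg _
    simp only [mem_ofPred_eq, mem_empty_iff_false, iff_false]
    linarith
  rw [this, measureReal_empty]

variable [IsProbabilityMeasure P]

lemma monotone_of_frequency (h : ∀ x : ℝ, P.real {ω | (N ω : ℝ) ≤ x} = F x) : Monotone F := by
  intro x y hxy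
  rw [← h, ← h]
  exact measureReal_mono fun ω hω => le_trans hω hxy

lemma le_one_of_frequency (h : ∀ x : ℝ, P.real {ω | (N ω : ℝ) ≤ x} = F x) (x : ℝ) : F x ≤ 1 := by
  rw [← h]; exact measureReal_le_one

lemma measureReal_frequency_eq (hN : Measurable N)
    (h : ∀ x : ℝ, P.real {ω | (N ω : ℝ) ≤ x} = F x) (n : ℕ) :
    P.real (N ⁻¹' {n}) = F n - F ((n : ℝ) - 1) := by
  have hu : {ω | (N ω : ℝ) ≤ n} = {ω | (N ω : ℝ) ≤ (n : ℝ) - 1} ∪ N ⁻¹' {n} := by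
    ext ω
    have h1 : (N ω : ℝ) ≤ (n : ℝ) - 1 ↔ N ω < n := by
      rw [le_sub_iff_add_le]; exact_mod_cast Nat.succ_le_iff
    simp only [mem_ofPred_eq, mem_union, h1, mem_preimage, mem_singleton_iff, Nat.cast_le]
    exact le_iff_lt_or_eq
  have hd : Disjoint {ω | (N ω : ℝ) ≤ (n : ℝ) - 1} (N ⁻¹' {n}) := by
    refine disjoint_left.2 fun ω hω hω' => ?_
    have h1 : N ω = n := hω'
    rw [mem_ofPred_eq, h1] at hω
    linarith
  rw [← h, ← h, hu, measureReal_union hd (hN (measurableSet_singleton n))]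
  ring

end Frequency

lemma measurable_severities {Ω : Type*} [MeasurableSpace Ω] {Y : ℕ → Ω → ℝ}
    (hY : ∀ i, Measurable (Y i)) (n : ℕ) : Measurable (severities Y n) := by
  unfold severities
  fun_prop

lemma map_ofLp_severities {Ω : Type*} [MeasurableSpace Ω] (P : Measure Ω) {Y : ℕ → Ω → ℝ}
    (hY : ∀ i, Measurable (Y i)) (n : ℕ) :
    (P.map (severities Y n)).map WithLp.ofLp = P.map fun ω (i : Fin n) => Y i ω :=
  Measure.map_map (by fun_prop) (measurable_severities hY n)

/-- The conditional law of the severities given `N = n`: the increments of the transformed copula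
between `F(n-1)` and `F(n)` only involve the section of the density at `F_α(n)`. -/
lemma TransformedCopulaCRM.hasLaw_severities {Ω : Type*} [MeasurableSpace Ω] {P : Measure Ω}
    [IsProbabilityMeasure P] {N : Ω → ℕ} {Y : ℕ → Ω → ℝ} {F : ℝ → ℝ}
    {α ρ₁ ρ₂ ξ σ : ℝ} (hα : α ∈ Ioo (0 : ℝ) 1) (hσ : 0 < σ)
    {h₁ : ρ₁ ^ 2 ≤ ρ₂} {h₂ : ρ₂ < 1}
    (hmodel : TransformedCopulaCRM P α F (normalCDF ξ σ) (exchGaussianCopula h₁ h₂) N Y)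
    {n : ℕ} (hn : 1 ≤ n) (hP : P (N ⁻¹' {n}) ≠ 0) :
    HasLaw (severities Y n)
      (multivariateGaussian (WithLp.toLp 2 fun _ => ξ + σ * ρ₁ * invPhi (Falpha α F n))
        (σ ^ 2 • condCov n ρ₁ ρ₂)) (P[|N ⁻¹' {n}]) := by
  have hF := monotone_of_frequency hmodel.frequency
  have hF0 := nonneg_of_frequency hmodel.frequency
  have hF1 := le_one_of_frequency hmodel.frequency
  have hFneg := neg_one_of_frequency hmodel.frequency
  have hpn := measureReal_frequency_eq hmodel.measurable_frequency hmodel.frequency n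
  have hpos : 0 < P.real (N ⁻¹' {n}) := by
    rw [measureReal_def]; exact ENNReal.toReal_pos hP (measure_ne_top _ _)
  have hprob : IsProbabilityMeasure (P[|N ⁻¹' {n}]) := cond_isProbabilityMeasure hP
  have hY := hmodel.measurable_severity
  have hsev := measurable_severities hY n
  set q := invPhi (Falpha α F n) with hq
  set ν := multivariateGaussian (WithLp.toLp 2 fun _ : Fin n => ξ + σ * ρ₁ * q)
    (σ ^ 2 • condCov n ρ₁ ρ₂) with hν
  have hνmap : ν = (multivariateGaussian (WithLp.toLp 2 fun _ : Fin n => ρ₁ * q)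
      (condCov n ρ₁ ρ₂)).map (fun x => WithLp.toLp 2 (fun _ => ξ) + σ • x) := by
    rw [multivariateGaussian_map_affine (condCov_posDef n h₁ h₂).posSemidef, hν]
    congr 1
    ext i
    simp [mul_assoc]
  have hofLp : Measurable (WithLp.ofLp : EuclideanSpace ℝ (Fin n) → Fin n → ℝ) := by fun_prop
  have key : ((P[|N ⁻¹' {n}]).map (severities Y n)).map WithLp.ofLp = ν.map WithLp.ofLp := by
    have : IsProbabilityMeasure ((P[|N ⁻¹' {n}]).map (severities Y n)) :=
      Measure.isProbabilityMeasure_map hsev.aemeasurable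
    have : IsProbabilityMeasure (((P[|N ⁻¹' {n}]).map (severities Y n)).map WithLp.ofLp) :=
      Measure.isProbabilityMeasure_map hofLp.aemeasurable
    have : IsProbabilityMeasure (ν.map WithLp.ofLp) :=
      Measure.isProbabilityMeasure_map hofLp.aemeasurable
    refine ext_of_lower_orthants fun y => ?_
    have hset : MeasurableSet {x : Fin n → ℝ | ∀ i, x i ≤ y i} :=
      (measurableSet_Iic : MeasurableSet (Iic y))
    -- `F_α(k)` lies in `(0,1)` for every atom `k`, so every section that occurs is integrable
    have hint (k : ℕ) (hk : F ((k : ℝ) - 1) < F k) :=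
      (integrableOn_section_and_integral n h₁ h₂ (Falpha_mem_Ioo hα hF0 hF1 hk)
        (v := fun i => normalCDF ξ σ (y i)) fun i => cdf_le_one _ _)
    rw [map_measureReal_apply hofLp hset, map_measureReal_apply hsev (hofLp hset),
      map_measureReal_apply hofLp hset]
    have hsv := hmodel.severity n hn hP y
    rw [transformedCopula_sub hF hF0 hFneg _ _ (fun k hk => (hint k hk).1), ← hpn,
      mul_div_cancel_left₀ _ hpos.ne', (hint n (by linarith)).2] at hsv
    refine hsv.trans ?_
    rw [hνmap, map_measureReal_apply (by fun_prop) (hofLp hset)]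
    congr 1
    ext x
    simp only [mem_ofPred_eq, mem_preimage, normalCDF_eq_Phi ξ hσ, strictMono_Phi.le_iff_le,
      le_div_iff₀ hσ, PiLp.add_apply, PiLp.smul_apply, smul_eq_mul]
    refine forall_congr' fun i => ?_
    constructor <;> intro h <;> linarith
  refine ⟨hsev.aemeasurable, ?_⟩
  have h := congrArg (Measure.map (WithLp.toLp 2)) key
  rw [Measure.map_map (by fun_prop) hofLp, Measure.map_map (by fun_prop) hofLp] at h
  simpa [Function.comp_def] using h

/-! ### Conditioning the normal vector on its first coordinate -/

/-- The kernel `z ↦ N((ξ + σ ρ₁ z) 1_n, σ² (Σ_{ρ₂} - ρ₁² J))`, realised as translates of a fixed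
centred normal law. -/
noncomputable def gaussianCondKernel (n : ℕ) (ρ₁ ρ₂ ξ σ : ℝ) :
    Kernel ℝ (EuclideanSpace ℝ (Fin n)) :=
  (Kernel.id ×ₖ Kernel.const ℝ (multivariateGaussian 0 (σ ^ 2 • condCov n ρ₁ ρ₂))).map
    fun p => (WithLp.toLp 2 fun _ => ξ + σ * ρ₁ * p.1) + p.2

lemma gaussianCondKernel_apply_eq_map (n : ℕ) (ρ₁ ρ₂ ξ σ z : ℝ) :
    gaussianCondKernel n ρ₁ ρ₂ ξ σ z =
      (multivariateGaussian 0 (σ ^ 2 • condCov n ρ₁ ρ₂)).map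
        fun x => (WithLp.toLp 2 fun _ => ξ + σ * ρ₁ * z) + x := by
  rw [gaussianCondKernel, Kernel.map_apply _ (by fun_prop), Kernel.prod_apply, Kernel.id_apply,
    Kernel.const_apply, Measure.dirac_prod, Measure.map_map (by fun_prop) (by fun_prop)]
  rfl

lemma gaussianCondKernel_apply (n : ℕ) {ρ₁ ρ₂ : ℝ} (h₁ : ρ₁ ^ 2 ≤ ρ₂) (h₂ : ρ₂ < 1)
    (ξ σ z : ℝ) :
    gaussianCondKernel n ρ₁ ρ₂ ξ σ z =
      multivariateGaussian (WithLp.toLp 2 fun _ => ξ + σ * ρ₁ * z)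
        (σ ^ 2 • condCov n ρ₁ ρ₂) := by
  have h := multivariateGaussian_map_affine
    ((condCov_posDef n h₁ h₂).posSemidef.smul (sq_nonneg σ)) 0
    (WithLp.toLp 2 fun _ => ξ + σ * ρ₁ * z) 1
  simp only [one_smul, smul_zero, add_zero, one_pow] at h
  rw [gaussianCondKernel_apply_eq_map, h]

instance isMarkovKernel_gaussianCondKernel (n : ℕ) (ρ₁ ρ₂ ξ σ : ℝ) :
    IsMarkovKernel (gaussianCondKernel n ρ₁ ρ₂ ξ σ) :=
  Kernel.IsMarkovKernel.map _ (by fun_prop)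

lemma continuous_integral_gaussianCondKernel (n : ℕ) (ρ₁ ρ₂ ξ σ : ℝ)
    (f : BoundedContinuousFunction (EuclideanSpace ℝ (Fin n)) ℝ) :
    Continuous fun z => ∫ w, f w ∂(gaussianCondKernel n ρ₁ ρ₂ ξ σ z) := by
  have h (z : ℝ) : ∫ w, f w ∂(gaussianCondKernel n ρ₁ ρ₂ ξ σ z) =
      ∫ x, f ((WithLp.toLp 2 fun _ => ξ + σ * ρ₁ * z) + x)
        ∂(multivariateGaussian 0 (σ ^ 2 • condCov n ρ₁ ρ₂)) := by
    rw [gaussianCondKernel_apply_eq_map, integral_map (by fun_prop)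
      f.continuous.aestronglyMeasurable]
  simp only [h]
  refine continuous_of_dominated (bound := fun _ => ‖f‖) (fun z => ?_) (fun z => ?_) ?_ ?_
  · exact (f.continuous.comp (by fun_prop)).aestronglyMeasurable
  · exact ae_of_all _ fun x => f.norm_coe_le_norm _
  · exact integrable_const _
  · exact ae_of_all _ fun x => f.continuous.comp (by fun_prop)

lemma quadForm_scaled_corrMatrix (n : ℕ) (ρ₁ ρ₂ σ : ℝ) (t : Fin (n + 1) → ℝ) :
    t ⬝ᵥ ((Matrix.diagonal (Fin.cons 1 fun _ => σ) * corrMatrix n ρ₁ ρ₂ *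
        Matrix.diagonal (Fin.cons 1 fun _ => σ)) *ᵥ t) =
      (t 0 + σ * ρ₁ * ∑ i, Fin.tail t i) ^ 2 +
        Fin.tail t ⬝ᵥ ((σ ^ 2 • condCov n ρ₁ ρ₂) *ᵥ Fin.tail t) := by
  have hD : Matrix.diagonal (Fin.cons 1 fun _ => σ) *ᵥ t =
      (Fin.cons (t 0) (σ • Fin.tail t) : Fin (n + 1) → ℝ) := by
    ext i
    refine Fin.cases ?_ (fun i => ?_) i <;> simp [Matrix.mulVec_diagonal, Fin.tail]
  have hD' : t ᵥ* Matrix.diagonal (Fin.cons 1 fun _ => σ) =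
      (Fin.cons (t 0) (σ • Fin.tail t) : Fin (n + 1) → ℝ) := by
    ext i
    refine Fin.cases ?_ (fun i => ?_) i <;> simp [Matrix.vecMul_diagonal, Fin.tail, mul_comm]
  rw [← Matrix.mulVec_mulVec, hD, ← Matrix.mulVec_mulVec, Matrix.dotProduct_mulVec, hD',
    corrMatrix_mulVec_cons, Matrix.smul_mulVec, condCov_mulVec, Matrix.mulVec_smul]
  have hcons (a b : ℝ) (x y : Fin n → ℝ) :
      (Fin.cons a x : Fin (n + 1) → ℝ) ⬝ᵥ Fin.cons b y = a * b + x ⬝ᵥ y := by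
    simp [dotProduct, Fin.sum_univ_succ]
  have hconst (x : Fin n → ℝ) (c : ℝ) : x ⬝ᵥ (fun _ => c) = c * ∑ i, x i := by
    simp [dotProduct, Finset.mul_sum, mul_comm]
  rw [hcons, dotProduct_add, dotProduct_smul, dotProduct_smul, dotProduct_sub, hconst, hconst]
  simp only [Pi.smul_apply, smul_eq_mul, smul_dotProduct, ← Finset.mul_sum]
  ring

lemma measurable_cons_shift (n : ℕ) (ρ₁ ξ σ : ℝ) :
    Measurable fun p : ℝ × EuclideanSpace ℝ (Fin n) =>
      (WithLp.toLp 2 (Fin.cons p.1 fun i => ξ + σ * ρ₁ * p.1 + p.2 i) :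
        EuclideanSpace ℝ (Fin (n + 1))) :=
  (MeasurableEquiv.toLp 2 (Fin (n + 1) → ℝ)).measurable.comp
    (measurable_finCons measurable_fst (by fun_prop))

/-- The normal vector with mean `(0, ξ, …, ξ)` and covariance matrix `D Σ_{ρ₁,ρ₂} D`, where
`D = diag(1, σ, …, σ)`, is obtained from independent `z ∼ N(0,1)` and
`x ∼ N(0, σ² (Σ_{ρ₂} - ρ₁² J))` as `(z, (ξ + σ ρ₁ z) 1_n + x)`. -/
lemma multivariateGaussian_scaled_corrMatrix (n : ℕ) {ρ₁ ρ₂ : ℝ} (h₁ : ρ₁ ^ 2 ≤ ρ₂) (h₂ : ρ₂ < 1)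
    (ξ σ : ℝ) :
    multivariateGaussian (WithLp.toLp 2 (Fin.cons 0 fun _ => ξ))
        (Matrix.diagonal (Fin.cons 1 fun _ => σ) * corrMatrix n ρ₁ ρ₂ *
          Matrix.diagonal (Fin.cons 1 fun _ => σ)) =
      ((gaussianReal 0 1).prod (multivariateGaussian 0 (σ ^ 2 • condCov n ρ₁ ρ₂))).map
        fun p => WithLp.toLp 2 (Fin.cons p.1 fun i => ξ + σ * ρ₁ * p.1 + p.2 i) := by
  have hA : (σ ^ 2 • condCov n ρ₁ ρ₂).PosSemidef :=
    (condCov_posDef n h₁ h₂).posSemidef.smul (sq_nonneg σ)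
  have hS : (Matrix.diagonal (Fin.cons 1 fun _ => σ) * corrMatrix n ρ₁ ρ₂ *
      Matrix.diagonal (Fin.cons 1 fun _ => σ)).PosSemidef := by
    have h := (corrMatrix_posDef n h₁ h₂).posSemidef.mul_mul_conjTranspose_same
      (Matrix.diagonal (Fin.cons 1 fun _ => σ))
    simpa [Matrix.diagonal_conjTranspose] using h
  have hmeas := measurable_cons_shift n ρ₁ ξ σ
  have : IsProbabilityMeasure (((gaussianReal 0 1).prod
      (multivariateGaussian 0 (σ ^ 2 • condCov n ρ₁ ρ₂))).map
        fun p => (WithLp.toLp 2 (Fin.cons p.1 fun i => ξ + σ * ρ₁ * p.1 + p.2 i) :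
          EuclideanSpace ℝ (Fin (n + 1)))) := Measure.isProbabilityMeasure_map hmeas.aemeasurable
  refine Measure.ext_of_charFun ?_
  ext t
  set T : EuclideanSpace ℝ (Fin n) := WithLp.toLp 2 (Fin.tail t.ofLp) with hT
  set s : ℝ := ∑ i, Fin.tail t.ofLp i with hs
  have hinner (p : ℝ × EuclideanSpace ℝ (Fin n)) :
      inner ℝ (WithLp.toLp 2 (Fin.cons p.1 fun i => ξ + σ * ρ₁ * p.1 + p.2 i)) t =
        (t 0 + σ * ρ₁ * s) * p.1 + inner ℝ p.2 T + ξ * s := by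
    simp only [PiLp.inner_apply, Fin.sum_univ_succ, hT, hs, Fin.tail]
    simp [mul_add, Finset.sum_add_distrib, ← Finset.sum_mul]
    ring
  have hsplit : ∀ p : ℝ × EuclideanSpace ℝ (Fin n),
      Complex.exp ((inner ℝ (WithLp.toLp 2 (Fin.cons p.1 fun i => ξ + σ * ρ₁ * p.1 + p.2 i)) t : ℝ) *
        Complex.I) =
      Complex.exp ((t 0 + σ * ρ₁ * s : ℝ) * p.1 * Complex.I) *
        (Complex.exp ((inner ℝ p.2 T : ℝ) * Complex.I) * Complex.exp ((ξ * s : ℝ) * Complex.I)) := by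
    intro p
    rw [hinner, ← Complex.exp_add, ← Complex.exp_add]
    congr 1
    push_cast
    ring
  rw [charFun_multivariateGaussian hS, charFun_apply, integral_map hmeas.aemeasurable
    (by fun_prop)]
  simp only [hsplit]
  rw [integral_prod_mul (fun x : ℝ => Complex.exp ((t 0 + σ * ρ₁ * s : ℝ) * x * Complex.I))
      (fun x : EuclideanSpace ℝ (Fin n) => Complex.exp ((inner ℝ x T : ℝ) * Complex.I) *
        Complex.exp ((ξ * s : ℝ) * Complex.I)),
    integral_mul_const, ← charFun_apply, ← charFun_apply_real, charFun_gaussianReal,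
    charFun_multivariateGaussian hA, ← Complex.exp_add, ← Complex.exp_add,
    quadForm_scaled_corrMatrix]
  have hmean : inner ℝ t (WithLp.toLp 2 (Fin.cons 0 fun _ => ξ)) = ξ * s := by
    simp only [PiLp.inner_apply, Fin.sum_univ_succ, hs, Fin.tail]
    simp [Finset.mul_sum]
  rw [hmean, inner_zero_right]
  congr 1
  simp only [hT, hs]
  push_cast
  ring

lemma hasCondDistrib_gaussianCondKernel {Ω : Type*} [MeasurableSpace Ω] {P : Measure Ω}
    [IsProbabilityMeasure P] {n : ℕ} {ρ₁ ρ₂ ξ σ : ℝ} (h₁ : ρ₁ ^ 2 ≤ ρ₂) (h₂ : ρ₂ < 1)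
    {Z : Ω → EuclideanSpace ℝ (Fin (n + 1))}
    (hZ : HasLaw Z (multivariateGaussian (WithLp.toLp 2 (Fin.cons 0 fun _ => ξ))
      (Matrix.diagonal (Fin.cons 1 fun _ => σ) * corrMatrix n ρ₁ ρ₂ *
        Matrix.diagonal (Fin.cons 1 fun _ => σ))) P) :
    HasLaw (fun ω => Z ω 0) (gaussianReal 0 1) P ∧
    HasCondDistrib (fun ω => WithLp.toLp 2 fun i : Fin n => Z ω i.succ) (fun ω => Z ω 0)
      (gaussianCondKernel n ρ₁ ρ₂ ξ σ) P := by
  set ν := multivariateGaussian 0 (σ ^ 2 • condCov n ρ₁ ρ₂) with hν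
  set φ : ℝ × EuclideanSpace ℝ (Fin n) → EuclideanSpace ℝ (Fin (n + 1)) :=
    fun p => WithLp.toLp 2 (Fin.cons p.1 fun i => ξ + σ * ρ₁ * p.1 + p.2 i) with hφ
  have hφm : Measurable φ := measurable_cons_shift n ρ₁ ξ σ
  have hlaw : P.map Z = ((gaussianReal 0 1).prod ν).map φ := by
    rw [hZ.map_eq, multivariateGaussian_scaled_corrMatrix n h₁ h₂]
  have hV : HasLaw (fun ω => Z ω 0) (gaussianReal 0 1) P := by
    refine ⟨by fun_prop, ?_⟩
    have h : (fun ω => Z ω 0) = (fun x : EuclideanSpace ℝ (Fin (n + 1)) => x 0) ∘ Z := rfl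
    rw [h, ← AEMeasurable.map_map_of_aemeasurable (by fun_prop) (by fun_prop), hlaw,
      Measure.map_map (by fun_prop) hφm]
    exact Measure.fst_prod
  refine ⟨hV, ⟨by fun_prop, ?_⟩⟩
  have hW : (fun ω => (Z ω 0, (WithLp.toLp 2 fun i : Fin n => Z ω i.succ :
      EuclideanSpace ℝ (Fin n)))) =
      (fun x : EuclideanSpace ℝ (Fin (n + 1)) => (x 0, (WithLp.toLp 2 fun i : Fin n => x i.succ :
        EuclideanSpace ℝ (Fin n)))) ∘ Z := rfl
  rw [hV.map_eq, hW, ← AEMeasurable.map_map_of_aemeasurable (by fun_prop) (by fun_prop), hlaw,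
    Measure.map_map (by fun_prop) hφm]
  have hcomp : (fun x : EuclideanSpace ℝ (Fin (n + 1)) => (x 0,
      (WithLp.toLp 2 fun i : Fin n => x i.succ : EuclideanSpace ℝ (Fin n)))) ∘ φ =
      fun p => (p.1, (WithLp.toLp 2 fun _ => ξ + σ * ρ₁ * p.1) + p.2) := by
    ext p
    · simp [hφ]
    · simp [hφ]
  rw [hcomp]
  have hψ : Measurable fun p : ℝ × EuclideanSpace ℝ (Fin n) =>
      (p.1, ((WithLp.toLp 2 fun _ => ξ + σ * ρ₁ * p.1) + p.2 : EuclideanSpace ℝ (Fin n))) := by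
    fun_prop
  ext S hS
  rw [Measure.map_apply hψ hS, Measure.prod_apply (hψ hS), Measure.compProd_apply hS]
  refine lintegral_congr fun z => ?_
  rw [gaussianCondKernel_apply_eq_map, Measure.map_apply (by fun_prop)
    (measurable_prodMk_left hS)]
  rfl

/-- Two continuous versions of a conditional distribution agree everywhere when the conditioning
variable is standard normal, since they agree Lebesgue-almost everywhere. -/
lemma IsContinuousCondDistrib.eq_of_hasLaw_gaussianReal {Ω E : Type*} [MeasurableSpace Ω]
    [TopologicalSpace E] [MeasurableSpace E] [BorelSpace E] [HasOuterApproxClosed E]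
    [MeasurableSpace.CountablyGenerated E] {P : Measure Ω} {W : Ω → E} {V : Ω → ℝ}
    {κ η : Kernel ℝ E} (hV : HasLaw V (gaussianReal 0 1) P)
    (hκ : IsContinuousCondDistrib W V κ P) (hη : IsContinuousCondDistrib W V η P) : κ = η := by
  have := hκ.isMarkovKernel
  have := hη.isMarkovKernel
  have hae : ⇑κ =ᵐ[gaussianReal 0 1] ⇑η := by
    refine Kernel.ae_eq_of_compProd_eq ?_
    rw [← hV.map_eq, ← hκ.hasCondDistrib.map_eq, ← hη.hasCondDistrib.map_eq]
  have hvol : ⇑κ =ᵐ[volume] ⇑η :=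
    (gaussianReal_absolutelyContinuous' 0 one_ne_zero).ae_eq hae
  ext1 z
  refine ext_of_forall_integral_eq_of_IsFiniteMeasure fun f => ?_
  have hf : (fun z => ∫ w, f w ∂(κ z)) =ᵐ[volume] fun z => ∫ w, f w ∂(η z) := by
    filter_upwards [hvol] with z hz
    rw [hz]
  exact congrFun ((Continuous.ae_eq_iff_eq volume (hκ.continuous f) (hη.continuous f)).1 hf) z

/-! ### Normal vectors with independent coordinates -/

lemma multivariateGaussian_smul_one (n : ℕ) (m : EuclideanSpace ℝ (Fin n)) {s : ℝ} (hs : 0 ≤ s) :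
    multivariateGaussian m (s • (1 : Matrix (Fin n) (Fin n) ℝ)) =
      (Measure.pi fun i => gaussianReal (m i) s.toNNReal).map (WithLp.toLp 2) := by
  have : IsProbabilityMeasure ((Measure.pi fun i => gaussianReal (m i) s.toNNReal).map
      (WithLp.toLp 2)) := Measure.isProbabilityMeasure_map (by fun_prop)
  refine Measure.ext_of_charFun ?_
  ext t
  rw [charFun_multivariateGaussian (Matrix.PosSemidef.one.smul hs), charFun_pi]
  simp_rw [charFun_gaussianReal]
  rw [← Complex.exp_sum]
  congr 1
  simp only [Finset.sum_sub_distrib, PiLp.inner_apply, Matrix.smul_mulVec, Matrix.one_mulVec,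
    dotProduct, Real.coe_toNNReal s hs, ← Finset.sum_mul, ← Finset.sum_div]
  simp only [Pi.smul_apply, smul_eq_mul, RCLike.inner_apply, conj_trivial]
  push_cast
  congr 2
  · congr 1
    exact funext fun i => mul_comm _ _
  · exact Finset.sum_congr rfl fun i _ => by ring

lemma condCov_sq (n : ℕ) (ρ : ℝ) :
    condCov n ρ (ρ ^ 2) = (1 - ρ ^ 2) • (1 : Matrix (Fin n) (Fin n) ℝ) := by
  ext i j
  by_cases hij : i = j <;> simp [condCov_apply, hij]

/-! ### Random vectors of random length -/

/-- The fibre over `n` of a subset of the space of vectors of arbitrary length. -/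
def lengthFibre (s : Set (Σ n : ℕ, (Fin n → ℝ))) (n : ℕ) : Set (Fin n → ℝ) := {y | ⟨n, y⟩ ∈ s}

/-- A subset of the disjoint union is measurable, by definition, iff all its fibres are. -/
lemma measurableSet_lengthFibre {s : Set (Σ n : ℕ, (Fin n → ℝ))} (hs : MeasurableSet s) (n : ℕ) :
    MeasurableSet (lengthFibre s n) :=
  iInf_le (fun n : ℕ => (MeasurableSpace.pi : MeasurableSpace (Fin n → ℝ)).map
    (Sigma.mk (β := fun n : ℕ => Fin n → ℝ) n)) n s hs

section CrmVector

variable {Ω : Type*} {N : Ω → ℕ} {Y : ℕ → Ω → ℝ}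

lemma crmVector_preimage (N : Ω → ℕ) (Y : ℕ → Ω → ℝ) (s : Set (Σ n : ℕ, (Fin n → ℝ))) :
    crmVector N Y ⁻¹' s =
      ⋃ n, N ⁻¹' {n} ∩ (fun ω (i : Fin n) => Y i ω) ⁻¹' lengthFibre s n := by
  ext ω
  simp only [mem_preimage, mem_iUnion, mem_inter_iff, mem_singleton_iff]
  exact ⟨fun h => ⟨N ω, rfl, h⟩, by rintro ⟨n, rfl, h⟩; exact h⟩

variable [MeasurableSpace Ω]

lemma measurableSet_crmVector_piece (hN : Measurable N) (hY : ∀ i, Measurable (Y i))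
    {s : Set (Σ n : ℕ, (Fin n → ℝ))} (hs : MeasurableSet s) (n : ℕ) :
    MeasurableSet (N ⁻¹' {n} ∩ (fun ω (i : Fin n) => Y i ω) ⁻¹' lengthFibre s n) := by
  have hm : Measurable fun ω (i : Fin n) => Y i ω := measurable_pi_lambda _ fun i => hY i
  exact (hN (measurableSet_singleton n)).inter (hm (measurableSet_lengthFibre hs n))

lemma measurable_crmVector (hN : Measurable N) (hY : ∀ i, Measurable (Y i)) :
    Measurable (crmVector N Y) := by
  intro s hs
  rw [crmVector_preimage]
  exact MeasurableSet.iUnion fun n => measurableSet_crmVector_piece hN hY hs n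

lemma map_crmVector_apply (P : Measure Ω) (hN : Measurable N) (hY : ∀ i, Measurable (Y i))
    {s : Set (Σ n : ℕ, (Fin n → ℝ))} (hs : MeasurableSet s) :
    P.map (crmVector N Y) s =
      ∑' n, P (N ⁻¹' {n} ∩ (fun ω (i : Fin n) => Y i ω) ⁻¹' lengthFibre s n) := by
  rw [Measure.map_apply (measurable_crmVector hN hY) hs, crmVector_preimage, measure_iUnion]
  · intro i j hij
    refine disjoint_left.2 fun ω hω hω' => hij ?_
    exact (hω.1 : N ω = i).symm.trans hω'.1
  · exact fun n => measurableSet_crmVector_piece hN hY hs n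

end CrmVector

/-- Two random vectors of random length are identically distributed as soon as their lengths are,
and so are the vectors themselves conditionally on each possible length. -/
lemma identDistrib_crmVector {Ω Ω' : Type*} [MeasurableSpace Ω] [MeasurableSpace Ω']
    {P : Measure Ω} {P' : Measure Ω'} [IsProbabilityMeasure P] [IsProbabilityMeasure P']
    {N : Ω → ℕ} {X : Ω' → ℕ} {Y : ℕ → Ω → ℝ} {Y' : ℕ → Ω' → ℝ}
    (hN : Measurable N) (hX : Measurable X) (hY : ∀ i, Measurable (Y i))
    (hY' : ∀ i, Measurable (Y' i)) (hlen : ∀ n, P (N ⁻¹' {n}) = P' (X ⁻¹' {n}))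
    (hcond : ∀ n, 1 ≤ n → P (N ⁻¹' {n}) ≠ 0 →
      (P[|N ⁻¹' {n}]).map (fun ω (i : Fin n) => Y i ω) =
        (P'[|X ⁻¹' {n}]).map (fun ω (i : Fin n) => Y' i ω)) :
    IdentDistrib (crmVector N Y) (crmVector X Y') P P' := by
  refine ⟨(measurable_crmVector hN hY).aemeasurable, (measurable_crmVector hX hY').aemeasurable, ?_⟩
  ext s hs
  rw [map_crmVector_apply P hN hY hs, map_crmVector_apply P' hX hY' hs]
  refine tsum_congr fun n => ?_
  by_cases h0 : P (N ⁻¹' {n}) = 0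
  · rw [measure_mono_null inter_subset_left h0,
      measure_mono_null inter_subset_left ((hlen n).symm.trans h0)]
  rcases Nat.eq_zero_or_pos n with rfl | hn
  · -- `Fin 0 → ℝ` is a singleton, so the fibre of `s` over `0` is empty or everything
    rcases Subsingleton.eq_empty_or_singleton (subsingleton_of_subsingleton (s := lengthFibre s 0))
      with h | ⟨y, h⟩
    · simp [h]
    · have h' : lengthFibre s 0 = univ := by
        rw [h]; exact eq_univ_of_forall fun x => Subsingleton.elim _ _
      simpa [h'] using hlen 0
  · have hm : Measurable fun ω (i : Fin n) => Y i ω := measurable_pi_lambda _ fun i => hY i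
    have hm' : Measurable fun ω (i : Fin n) => Y' i ω := measurable_pi_lambda _ fun i => hY' i
    have hsn := measurableSet_lengthFibre hs n
    rw [← cond_mul_eq_inter (hN (measurableSet_singleton n)),
      ← cond_mul_eq_inter (hX (measurableSet_singleton n)), hlen n,
      ← Measure.map_apply hm hsn, ← Measure.map_apply hm' hsn, hcond n hn h0]

/-! ### The normal two-part model -/

/-- Given `X = n`, the severities of the normal two-part model with means `μ n` and dispersion `s`
form a normal vector with covariance matrix `s • 1`. -/
lemma TwoPartCRM.map_severities {Ω : Type*} [MeasurableSpace Ω] {P : Measure Ω}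
    [IsProbabilityMeasure P] {X : Ω → ℕ} {Y : ℕ → Ω → ℝ} {F : ℝ → ℝ} {μ : ℕ → ℝ} {s : ℝ}
    (hs : 0 ≤ s) (hmodel : TwoPartCRM P F normalED μ s X Y) {n : ℕ} (hn : 1 ≤ n)
    (hP : P (X ⁻¹' {n}) ≠ 0) :
    (P[|X ⁻¹' {n}]).map (severities Y n) =
      multivariateGaussian (WithLp.toLp 2 fun _ => μ n)
        (s • (1 : Matrix (Fin n) (Fin n) ℝ)) := by
  have : IsProbabilityMeasure (P[|X ⁻¹' {n}]) := cond_isProbabilityMeasure hP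
  have hY := hmodel.measurable_severity
  have hm : Measurable fun ω (i : Fin n) => Y i ω := measurable_pi_lambda _ fun i => hY i
  have hpi : (P[|X ⁻¹' {n}]).map (fun ω (i : Fin n) => Y i ω) =
      Measure.pi fun _ : Fin n => gaussianReal (μ n) s.toNNReal := by
    rw [(iIndepFun_iff_map_fun_eq_pi_map fun i : Fin n => (hY i).aemeasurable).1
      (hmodel.independent n hn hP)]
    congr 1
    ext1 i
    exact (hmodel.severity n hn hP i).map_eq
  have hsev : severities Y n = WithLp.toLp 2 ∘ fun ω (i : Fin n) => Y i ω := rfl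
  rw [hsev, ← Measure.map_map (by fun_prop) hm, hpi, multivariateGaussian_smul_one n _ hs]

end CRM

theorem mainTheorem4 {Ω : Type*} [MeasurableSpace Ω] (P : Measure Ω)
    [IsProbabilityMeasure P] (N : Ω → ℕ) (Y : ℕ → Ω → ℝ) (F : ℝ → ℝ)
    (α ρ₁ ρ₂ ξ σ : ℝ) (hα : α ∈ Ioo (0 : ℝ) 1) (hσ : 0 < σ)
    (h₁ : ρ₁ ^ 2 ≤ ρ₂) (h₂ : ρ₂ < 1)
    (hmodel : CRM.TransformedCopulaCRM P α F (CRM.normalCDF ξ σ)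
      (CRM.exchGaussianCopula h₁ h₂) N Y) :
    (∀ n : ℕ, 1 ≤ n → P (N ⁻¹' {n}) ≠ 0 →
      HasLaw (CRM.severities Y n)
        (multivariateGaussian
          (WithLp.toLp 2 fun _ => ξ + σ * ρ₁ * CRM.invPhi (CRM.Falpha α F n))
          (σ ^ 2 • (CRM.exchMatrix n ρ₂ - ρ₁ ^ 2 • CRM.onesMatrix n)))
        (P[|N ⁻¹' {n}]) ∧
      ∀ {Ω' : Type*} [MeasurableSpace Ω'] (P' : Measure Ω') [IsProbabilityMeasure P']
        (Z : Ω' → EuclideanSpace ℝ (Fin (n + 1))),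
        HasLaw Z
          (multivariateGaussian (WithLp.toLp 2 (Fin.cons 0 fun _ => ξ))
            (Matrix.diagonal (Fin.cons 1 fun _ => σ) * CRM.corrMatrix n ρ₁ ρ₂ *
              Matrix.diagonal (Fin.cons 1 fun _ => σ))) P' →
        (∃ κ : Kernel ℝ (EuclideanSpace ℝ (Fin n)),
          CRM.IsContinuousCondDistrib (fun ω => WithLp.toLp 2 fun i : Fin n => Z ω i.succ)
            (fun ω => Z ω 0) κ P') ∧
        ∀ κ : Kernel ℝ (EuclideanSpace ℝ (Fin n)),
          CRM.IsContinuousCondDistrib (fun ω => WithLp.toLp 2 fun i : Fin n => Z ω i.succ)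
            (fun ω => Z ω 0) κ P' →
          (P[|N ⁻¹' {n}]).map (CRM.severities Y n) = κ (CRM.invPhi (CRM.Falpha α F n)) ∧
          κ (CRM.invPhi (CRM.Falpha α F n)) =
            multivariateGaussian
              (WithLp.toLp 2 fun _ => ξ + σ * ρ₁ * CRM.invPhi (CRM.Falpha α F n))
              (σ ^ 2 • (CRM.exchMatrix n ρ₂ - ρ₁ ^ 2 • CRM.onesMatrix n))) ∧
    (ρ₂ = ρ₁ ^ 2 →
      ∀ {Ω'' : Type*} [MeasurableSpace Ω''] (P'' : Measure Ω'') [IsProbabilityMeasure P'']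
        (X : Ω'' → ℕ) (Y' : ℕ → Ω'' → ℝ) (μ : ℕ → ℝ) (σ₀sq : ℝ),
        CRM.TwoPartCRM P'' F CRM.normalED μ σ₀sq X Y' →
        (∀ n : ℕ, 1 ≤ n → P'' (X ⁻¹' {n}) ≠ 0 →
          μ n = ξ + σ * ρ₁ * CRM.invPhi (CRM.Falpha α F n)) →
        σ₀sq = σ ^ 2 * (1 - ρ₁ ^ 2) →
        IdentDistrib (CRM.crmVector N Y) (CRM.crmVector X Y') P P'') := by
  refine ⟨fun n hn hP => ?_, ?_⟩
  · have hlaw := hmodel.hasLaw_severities hα hσ hn hP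
    refine ⟨hlaw, fun {Ω'} _ P' _ Z hZ => ?_⟩
    obtain ⟨hV, hcond⟩ := CRM.hasCondDistrib_gaussianCondKernel h₁ h₂ hZ
    have hη : CRM.IsContinuousCondDistrib (fun ω => WithLp.toLp 2 fun i : Fin n => Z ω i.succ)
        (fun ω => Z ω 0) (CRM.gaussianCondKernel n ρ₁ ρ₂ ξ σ) P' :=
      ⟨inferInstance, hcond, CRM.continuous_integral_gaussianCondKernel n ρ₁ ρ₂ ξ σ⟩
    refine ⟨⟨_, hη⟩, fun κ hκ => ?_⟩
    rw [hκ.eq_of_hasLaw_gaussianReal hV hη, CRM.gaussianCondKernel_apply n h₁ h₂]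
    exact ⟨hlaw.map_eq, rfl⟩
  · rintro rfl Ω'' _ P'' _ X Y' μ σ₀sq htwo hμ rfl
    have hN := hmodel.measurable_frequency
    have hX := htwo.measurable_frequency
    have hlen (n : ℕ) : P (N ⁻¹' {n}) = P'' (X ⁻¹' {n}) := by
      rw [← measureReal_eq_measureReal_iff,
        CRM.measureReal_frequency_eq hN hmodel.frequency,
        CRM.measureReal_frequency_eq hX htwo.frequency]
    refine CRM.identDistrib_crmVector hN hX hmodel.measurable_severity htwo.measurable_severity
      hlen fun n hn hP => ?_
    have hP'' : P'' (X ⁻¹' {n}) ≠ 0 := hlen n ▸ hP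
    have hvar : 0 ≤ σ ^ 2 * (1 - ρ₁ ^ 2) := mul_nonneg (sq_nonneg σ) (by linarith)
    have heq : (P[|N ⁻¹' {n}]).map (CRM.severities Y n) =
        (P''[|X ⁻¹' {n}]).map (CRM.severities Y' n) := by
      rw [(hmodel.hasLaw_severities hα hσ hn hP).map_eq, htwo.map_severities hvar hn hP'',
        CRM.condCov_sq, hμ n hn hP'', smul_smul]
    have h := congrArg (Measure.map WithLp.ofLp) heq
    rwa [CRM.map_ofLp_severities _ hmodel.measurable_severity,
      CRM.map_ofLp_severities _ htwo.measurable_severity] at h
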